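/- Let $R$ be a nonzero associative ring with identity. Consider the abstract elementary class of left $R$-modules with embeddings: its models are the left $R$-modules, ordered by $M\leq N$ iff $M$ is a submodule of $N$, and its embeddings are the injective $R$-linear maps. Write $\|M\|$ for the cardinality of $M$, and for a cardinal $\lambda$ let $\mathbf K_\lambda$ be the class of left $R$-modules of cardinality $\lambda$. We use the following notions. * Galois types. For a module $M$ consider pairs $(b,N)$ with $M\leq N$ and $b\in N$. Two pairs $(b_1,N_1)$, $(b_2,N_2)$ are atomically equivalent if there are a module $L$ and embeddings $f_\ell:N_\ell\to L$ ($\ell=1,2$) with $f_1|_M=f_2|_M$ and $f_1(b_1)=f_2(b_2)$. Then $\mathbf{gS}(M)$ is the collection of classes of the transitive closure of this relation. The class is $\lambda$-stable if $|\mathbf{gS}(M)|\leq\lambda$ for every $M\in\mathbf K_\lambda$. * Limit models. $M$ is universal over $N$ if $N\leq M$, $\|M\|=\|N\|$, and for every module $N^*\geq N$ with $\|N^*\|=\|N\|$ there is an embedding $N^*\to M$ fixing $N$ pointwise. Let $\lambda$ be an infinite cardinal. $M$ is a limit model of cardinality $\lambda$ if, for some limit ordinal $\alpha<\lambda^+$,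 $M=\bigcup_{i<\alpha}M_i$ for an increasing continuous chain $(M_i)_{i<\alpha}$ in $\mathbf K_\lambda$ such that $M_{i+1}$ is universal over $M_i$ for every $i<\alpha$. The class has uniqueness of limit models of cardinality $\lambda$ if there is a limit model of cardinality $\lambda$ and any two such are isomorphic. The class is superstable if there is a cardinal $\mu$ such that it has uniqueness of limit models of cardinality $\lambda$ for every $\lambda\geq\mu$. * Superlimits. For $\lambda\geq|R|+\aleph_0$, $M$ is a superlimit of cardinality $\lambda$ if $M\in\mathbf K_\lambda$; every $N\in\mathbf K_\lambda$ has a non-surjective embedding into $M$; and for every nonzero ordinal $\delta<\lambda^+$ and every increasing chain $(M_i)_{i<\delta}$ of modules isomorphic to $M$, the union $\bigcup_{i<\delta}M_i$ is isomorphic to $M$. * $M$ is $\Sigma$-injective if the direct sum $M^{(I)}$ is injective for every index set $I$. Then the following are equivalent. 1. $R$ is left noetherian. 2. The class of left $R$-modules with embeddings is superstable. 3. For every $\lambda\geq|R|+\aleph_0$ there is $\chi\geq\lambda$ such that the class of left $R$-modules with embeddings has uniqueness of limit models of cardinality $\chi$. 4. For every $\lambda\geq|R|+\aleph_0$, the class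 of left $R$-modules with embeddings has uniqueness of limit models of cardinality $\lambda$. 5. For every $\lambda\geq(|R|+\aleph_0)^+$, the class of left $R$-modules with embeddings has a superlimit of cardinality $\lambda$. 6. For every $\lambda\geq|R|+\aleph_0$, the class of left $R$-modules with embeddings is $\lambda$-stable. 7. For every $\lambda\geq|R|+\aleph_0$, every limit model of cardinality $\lambda$ in the class of left $R$-modules with embeddings is $\Sigma$-injective. -/

import Mathlib

open Cardinal

universe u

/-! Throughout, `R` is a ring and models are left `R`-modules living in the universe of `R`.
The class of left `R`-modules is ordered by "being a submodule"; accordingly its morphisms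
("embeddings") are the injective `R`-linear maps, and `#M` is the cardinality of a model. -/

namespace ModEmb

section Types

variable (R : Type u) [Ring R] (M : Type u) [AddCommGroup M] [Module R M]

/-- A pair `(b, N)` with `N` an extension of `M` (along an embedding `M → N`) and `b ∈ N`. -/
structure PointedExt where
  /-- the extension `N` -/
  carrier : Type u
  [grp : AddCommGroup carrier]
  [mod : Module R carrier]
  /-- the embedding of `M` into `N` -/
  emb : M →ₗ[R] carrier
  emb_injective : Function.Injective emb
  /-- the element `b` of `N` -/
  point : carrier

attribute [instance] PointedExt.grp PointedExt.mod

variable {R M}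

/-- The relation `E_at`: both extensions embed over `M` into a common module in such a way that
the two distinguished elements are identified. -/
def PointedExt.AtRel (p q : PointedExt R M) : Prop :=
  ∃ (L : Type u) (_ : AddCommGroup L) (_ : Module R L)
    (f : p.carrier →ₗ[R] L) (g : q.carrier →ₗ[R] L),
    Function.Injective f ∧ Function.Injective g ∧
      f ∘ₗ p.emb = g ∘ₗ q.emb ∧ f p.point = g q.point

theorem PointedExt.AtRel.refl (p : PointedExt R M) : p.AtRel p :=
  ⟨p.carrier, inferInstance, inferInstance, LinearMap.id, LinearMap.id,
    Function.injective_id, Function.injective_id, rfl, rfl⟩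

theorem PointedExt.AtRel.symm {p q : PointedExt R M} (h : p.AtRel q) : q.AtRel p := by
  obtain ⟨L, i₁, i₂, f, g, hf, hg, h₁, h₂⟩ := h
  exact ⟨L, i₁, i₂, g, f, hg, hf, h₁.symm, h₂.symm⟩

variable (R M)

/-- Equality of Galois types: the transitive closure of `E_at`. -/
def galoisSetoid : Setoid (PointedExt R M) where
  r := Relation.TransGen PointedExt.AtRel
  iseqv :=
    { refl := fun p => Relation.TransGen.single (PointedExt.AtRel.refl p)
      symm := fun h => by
        induction h with
        | single h => exact Relation.TransGen.single h.symm
        | tail _ h ih => exact Relation.TransGen.head h.symm ih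
      trans := fun h₁ h₂ => h₁.trans h₂ }

/-- The Galois types over `M` of single elements, `gS(M)`. -/
def GaloisType : Type (u + 1) := Quotient (galoisSetoid R M)

end Types

/-- The class of left `R`-modules with embeddings is `κ`-stable: `|gS(M)| ≤ κ` for every model `M`
of cardinality `κ`. -/
def Stable (R : Type u) [Ring R] (κ : Cardinal.{u}) : Prop :=
  ∀ (M : Type u) [AddCommGroup M] [Module R M], #M = κ →
    #(GaloisType R M) ≤ Cardinal.lift.{u + 1} κ

/-- `M` is universal over `N`, where `N` is seen as a submodule of `M` through `i`:
`N` and `M` have the same cardinality, and every extension `N'` of `N` of that cardinality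
embeds into `M` over `N`. -/
def UniversalOver {R : Type u} [Ring R] {N M : Type u} [AddCommGroup N] [Module R N]
    [AddCommGroup M] [Module R M] (i : N →ₗ[R] M) : Prop :=
  Function.Injective i ∧ #M = #N ∧
    ∀ (N' : Type u) [AddCommGroup N'] [Module R N'] (j : N →ₗ[R] N'),
      Function.Injective j → #N' = #N →
        ∃ f : N' →ₗ[R] M, Function.Injective f ∧ f ∘ₗ j = i

section Limit

variable (R : Type u) [Ring R]

/-- `M` is a `(κ, α)`-limit model over its submodule `N`: it is the union of an increasing
continuous chain `(C i)_{i < α}` of submodules of cardinality `κ` with `C 0 = N` and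
`C (i + 1)` universal over `C i`. Only the values `C i` with `i < α` matter. -/
def IsLimitModelOver (κ : Cardinal.{u}) (α : Ordinal.{u})
    (M : Type u) [AddCommGroup M] [Module R M] (N : Submodule R M) : Prop :=
  ∃ C : Ordinal.{u} → Submodule R M,
    C 0 = N ∧
    (∀ i < α, #(C i) = κ) ∧
    (∀ i j, i ≤ j → j < α → C i ≤ C j) ∧
    (∀ j < α, Order.IsSuccLimit j → ∀ x ∈ C j, ∃ i < j, x ∈ C i) ∧
    (∀ i < α, ∃ h : C i ≤ C (i + 1), UniversalOver (Submodule.inclusion h)) ∧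
    ∀ x : M, ∃ i < α, x ∈ C i

/-- `M` is a limit model of cardinality `κ`: `κ` is infinite and `M` is a `(κ, α)`-limit model
for some limit ordinal `α < κ⁺`. -/
def IsLimitModel (κ : Cardinal.{u}) (M : Type u) [AddCommGroup M] [Module R M] : Prop :=
  ℵ₀ ≤ κ ∧ ∃ α : Ordinal.{u}, Order.IsSuccLimit α ∧ α < (Order.succ κ).ord ∧
    ∃ N : Submodule R M, IsLimitModelOver R κ α M N

/-- Uniqueness of limit models of cardinality `κ`: there is one, and any two are isomorphic. -/
def UniqueLimitModels (κ : Cardinal.{u}) : Prop :=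
  (∃ (M : Type u) (_ : AddCommGroup M) (_ : Module R M), IsLimitModel R κ M) ∧
    ∀ (M N : Type u) [AddCommGroup M] [Module R M] [AddCommGroup N] [Module R N],
      IsLimitModel R κ M → IsLimitModel R κ N → Nonempty (M ≃ₗ[R] N)

/-- Superstability: uniqueness of limit models in a tail of cardinals. -/
def Superstable : Prop :=
  ∃ μ : Cardinal.{u}, ∀ κ : Cardinal.{u}, μ ≤ κ → UniqueLimitModels R κ

/-- `M` is a superlimit in `κ ≥ |R| + ℵ₀` (the Löwenheim-Skolem number of the class).
In the last clause `L` is the union of the increasing chain `(C i)_{i < δ}` of isomorphic copies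
of `M`; since `0 ∈ L`, the chain is nonempty. -/
def IsSuperlimit (κ : Cardinal.{u}) (M : Type u) [AddCommGroup M] [Module R M] : Prop :=
  #R + ℵ₀ ≤ κ ∧ #M = κ ∧
    (∀ (N : Type u) [AddCommGroup N] [Module R N], #N = κ →
      ∃ f : N →ₗ[R] M, Function.Injective f ∧ ¬ Function.Surjective f) ∧
    ∀ (L : Type u) [AddCommGroup L] [Module R L] (δ : Ordinal.{u})
      (C : Ordinal.{u} → Submodule R L),
      δ < (Order.succ κ).ord →
      (∀ i j, i ≤ j → j < δ → C i ≤ C j) →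
      (∀ i < δ, Nonempty (C i ≃ₗ[R] M)) →
      (∀ x : L, ∃ i < δ, x ∈ C i) →
        Nonempty (L ≃ₗ[R] M)

/-- The class of left `R`-modules with embeddings has a superlimit of cardinality `κ`. -/
def HasSuperlimit (κ : Cardinal.{u}) : Prop :=
  ∃ (M : Type u) (_ : AddCommGroup M) (_ : Module R M), IsSuperlimit R κ M

/-- `M` is `Σ`-injective: every direct sum `M^(I)` of copies of `M` is injective. -/
def SigmaInjective (M : Type u) [AddCommGroup M] [Module R M] : Prop :=
  ∀ I : Type u, Module.Injective R (I →₀ M)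

end Limit

end ModEmb

/-! Everything turns on whether limit models are injective. By Baer's criterion a limit model is
injective once every map from a left ideal into it lands in one stage of the chain, for universality
then solves the map at the next stage (`IsLimitModelOver.injective_of_bounded`). This always happens
for lengths of cofinality above `#R`, and for all lengths if `R` is left noetherian.

For noetherian `R`, a limit model is thus an injective module of size `κ` containing every module of
size at most `κ`. Such modules are unique up to isomorphism by a swindle
(`nonempty_equiv_of_injective`) and closed under unions of chains of length below `κ⁺`; this yields
uniqueness, superlimits and `Σ`-injectivity. For stability, a universal extension of `M` has `κ`
elements and realizes every type over `M`.

Conversely, an injective limit model of length `ω` forces `R` to be noetherian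
(`IsLimitModelOver.isNoetherianRing`). If left ideals `I n` increase without stabilizing, take the
diagonal map from their union to the direct sum of the `R ⧸ I n`, and embed the `n`-th summand in
stage `n + 1` so that it meets stage `n` trivially. The composite is unbounded in the chain, yet
injectivity makes it `r ↦ r • e` with `e` in a single stage. Uniqueness identifies the model of
length `ω` with a long, hence injective, one; a superlimit is a limit model of both lengths;
`Σ`-injectivity applies to length `ω` directly. Against stability, the same diagonal spread along `κ
^ ℵ₀` branches gives too many types when `κ < κ ^ ℵ₀`. -/

namespace ModEmb

/-! ### Transfinite chains in a complete lattice. -/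

section Lattice

variable {L : Type*} [CompleteLattice L]

/-- Transfinite iteration of a step that preserves `P`, with suprema at limits. -/
theorem exists_continuous_chain (θ : Ordinal.{u}) (P : L → Prop) (Q : L → L → Prop)
    (A : L) (hA : P A) (step : ∀ N, P N → ∃ N', N ≤ N' ∧ P N' ∧ Q N N')
    (lim : ∀ i < θ, Order.IsSuccLimit i → ∀ C : Ordinal.{u} → L, Monotone C →
      (∀ j < i, P (C j)) → P (⨆ j : Set.Iio i, C j)) :
    ∃ C : Ordinal.{u} → L, C 0 = A ∧ Monotone C ∧
      (∀ i, Order.IsSuccLimit i → C i = ⨆ j : Set.Iio i, C j) ∧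
      (∀ i < θ, P (C i)) ∧ ∀ i < θ, Q (C i) (C (i + 1)) := by
  classical
  -- Off `P` the step is the identity, so the chain is monotone on all ordinals although `P` is
  -- controlled only below `θ`.
  let F : L → L := fun N => if h : P N then (step N h).choose else N
  have hF : ∀ N, N ≤ F N := fun N => by
    by_cases h : P N
    · simpa [F, h] using (step N h).choose_spec.1
    · simp [F, h]
  have hFP : ∀ N, P N → P (F N) ∧ Q N (F N) := fun N h => by
    simpa [F, h] using (step N h).choose_spec.2
  let C : Ordinal.{u} → L := fun i =>
    Ordinal.limitRecOn i A (fun _ N => F N) (fun i _ c => ⨆ j : Set.Iio i, c j j.2)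
  have h0 : C 0 = A := Ordinal.limitRecOn_zero ..
  have hs : ∀ i, C (i + 1) = F (C i) := fun i => Ordinal.limitRecOn_add_one ..
  have hl : ∀ i, Order.IsSuccLimit i → C i = ⨆ j : Set.Iio i, C j := fun i hi =>
    Ordinal.limitRecOn_limit _ _ _ _ hi
  have hmono : Monotone C := by
    intro i j
    induction j using Ordinal.limitRecOn with
    | zero => intro h; rw [nonpos_iff_eq_zero.1 h]
    | add_one j ih =>
      intro h
      rcases h.eq_or_lt with rfl | h
      · exact le_rfl
      · exact (ih (Order.lt_add_one_iff.1 h)).trans (hs j ▸ hF _)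
    | limit j hj ih =>
      intro h
      rcases h.eq_or_lt with rfl | h
      · exact le_rfl
      · rw [hl j hj]
        exact le_iSup (fun k : Set.Iio j => C k) ⟨i, h⟩
  have hP : ∀ i < θ, P (C i) := by
    intro i
    induction i using Ordinal.limitRecOn with
    | zero => intro _; rwa [h0]
    | add_one i ih =>
      intro h
      rw [hs]
      exact (hFP _ (ih ((Order.lt_add_one_iff.2 le_rfl).trans h))).1
    | limit i hi ih =>
      intro h
      rw [hl i hi]
      exact lim i h hi C hmono fun j hj => ih j hj (hj.trans h)
  exact ⟨C, h0, hmono, hl, hP, fun i hi => hs i ▸ (hFP _ (hP i hi)).2⟩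

end Lattice

/-! ### Cardinality bounds for submodules and unions. -/

section Cardinality

variable {R : Type u} [Ring R]

theorem mk_finsupp_le {α β : Type u} [Zero β] {κ : Cardinal.{u}} (hκ : ℵ₀ ≤ κ)
    (hα : #α ≤ κ) (hβ : #β ≤ κ) : #(α →₀ β) ≤ κ := by
  cases isEmpty_or_nonempty α
  · exact (le_one_iff_subsingleton.2 inferInstance).trans (one_le_aleph0.trans hκ)
  cases subsingleton_or_nontrivial β
  · exact (le_one_iff_subsingleton.2 inferInstance).trans (one_le_aleph0.trans hκ)
  cases finite_or_infinite α
  · cases finite_or_infinite β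
    · have := Finite.of_injective (fun f : α →₀ β => (f : α → β)) DFunLike.coe_injective
      exact (mk_lt_aleph0 (α := α →₀ β)).le.trans hκ
    · rw [mk_finsupp_of_infinite']
      exact max_le hα hβ
  · rw [mk_finsupp_of_infinite]
    exact max_le hα hβ

theorem mk_span_le {M : Type u} [AddCommGroup M] [Module R M] {κ : Cardinal.{u}} (hκ : ℵ₀ ≤ κ)
    (hR : #R ≤ κ) {s : Set M} (hs : #s ≤ κ) : #(Submodule.span R s) ≤ κ := by
  have h := Finsupp.range_linearCombination R (v := ((↑) : s → M))
  rw [Subtype.range_coe] at h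
  rw [← h]
  exact (mk_le_of_surjective (LinearMap.surjective_rangeRestrict _)).trans (mk_finsupp_le hκ hs hR)

theorem mk_sup_le {M : Type u} [AddCommGroup M] [Module R M] {κ : Cardinal.{u}} (hκ : ℵ₀ ≤ κ)
    {A B : Submodule R M} (hA : #A ≤ κ) (hB : #B ≤ κ) : #(A ⊔ B : Submodule R M) ≤ κ := by
  have h : Function.Surjective fun p : A × B =>
      (⟨p.1 + p.2, Submodule.add_mem_sup p.1.2 p.2.2⟩ : (A ⊔ B : Submodule R M)) := by
    rintro ⟨x, hx⟩
    obtain ⟨a, ha, b, hb, rfl⟩ := Submodule.mem_sup.1 hx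
    exact ⟨(⟨a, ha⟩, ⟨b, hb⟩), rfl⟩
  refine (mk_le_of_surjective h).trans ?_
  rw [mk_prod, lift_id, lift_id]
  exact mul_le_of_le hκ hA hB

theorem mk_prod_le {α β : Type u} {κ : Cardinal.{u}} (hκ : ℵ₀ ≤ κ) (hα : #α ≤ κ) (hβ : #β ≤ κ) :
    #(α × β) ≤ κ := by
  rw [mk_prod, lift_id, lift_id]
  exact mul_le_of_le hκ hα hβ

theorem mem_iSup_Iio {M : Type u} [AddCommGroup M] [Module R M] {i : Ordinal.{u}} (hi : 0 < i)
    {C : Ordinal.{u} → Submodule R M} (hC : ∀ j k, j ≤ k → k < i → C j ≤ C k) {x : M} :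
    x ∈ (⨆ j : Set.Iio i, C j) ↔ ∃ j < i, x ∈ C j := by
  have : Nonempty (Set.Iio i) := ⟨⟨0, hi⟩⟩
  rw [Submodule.mem_iSup_of_directed]
  · simp
  · intro j k
    rcases le_total j k with h | h
    · exact ⟨k, hC _ _ h k.2, le_rfl⟩
    · exact ⟨j, le_rfl, hC _ _ h j.2⟩

/-- A union indexed by an ordinal below `κ⁺` of sets of size at most `κ` has size at most `κ`. -/
theorem mk_le_of_forall_exists_mem {M : Type u} {κ : Cardinal.{u}} (hκ : ℵ₀ ≤ κ)
    {i : Ordinal.{u}} (hi : i < (Order.succ κ).ord) {C : Ordinal.{u} → Set M}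
    (hC : ∀ j < i, #(C j) ≤ κ) (h : ∀ x : M, ∃ j < i, x ∈ C j) : #M ≤ κ := by
  have hcard : #i.ToType ≤ κ := by
    rw [mk_toType]
    exact Order.lt_succ_iff.1 (lt_ord.1 hi)
  have hU : (⋃ j : i.ToType, C (j.toOrd : Ordinal)) = Set.univ := by
    refine Set.eq_univ_of_forall fun x => ?_
    obtain ⟨j, hj, hx⟩ := h x
    exact Set.mem_iUnion.2 ⟨Ordinal.ToType.mk ⟨j, hj⟩, by simpa using hx⟩
  rw [← mk_univ, ← hU]
  refine (mk_iUnion_le _).trans ?_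
  refine mul_le_of_le hκ hcard (ciSup_le' fun j => hC _ ?_)
  exact j.toOrd.2

theorem mk_iSup_Iio_le {M : Type u} [AddCommGroup M] [Module R M] {κ : Cardinal.{u}}
    (hκ : ℵ₀ ≤ κ) {i : Ordinal.{u}} (h0 : 0 < i) (hi : i < (Order.succ κ).ord)
    {C : Ordinal.{u} → Submodule R M} (hC : ∀ j k, j ≤ k → k < i → C j ≤ C k)
    (h : ∀ j < i, #(C j) ≤ κ) : #(⨆ j : Set.Iio i, C j : Submodule R M) ≤ κ := by
  refine mk_le_of_forall_exists_mem (C := fun j => {x | (x : M) ∈ C j}) hκ hi (fun j hj => ?_) ?_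
  · refine (mk_le_of_injective (f := fun x => (⟨x.1.1, x.2⟩ : C j)) ?_).trans (h j hj)
    exact fun x y hxy => Subtype.ext (Subtype.ext (congrArg (fun z : C j => (z : M)) hxy))
  · rintro ⟨x, hx⟩
    simpa using (mem_iSup_Iio h0 hC).1 hx

end Cardinality

/-! ### Injective modules and amalgamation. -/

section Injective

variable {R : Type u} [Ring R]

theorem exists_injective_embedding (M : Type u) [AddCommGroup M] [Module R M] :
    ∃ (E : Type u) (_ : AddCommGroup E) (_ : Module R E), Module.Injective R E ∧
      ∃ f : M →ₗ[R] E, Function.Injective f := by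
  obtain ⟨p⟩ := CategoryTheory.EnoughInjectives.presentation (ModuleCat.of R M)
  have hJ := p.injective
  refine ⟨p.J, inferInstance, inferInstance, ?_, p.f.hom, ?_⟩
  · exact Module.injective_module_of_injective_object R p.J
  · exact (ModuleCat.mono_iff_injective p.f).1 p.mono

theorem injective_iff_exists_smul {M : Type u} [AddCommGroup M] [Module R M] :
    Module.Injective R M ↔
      ∀ (I : Ideal R) (f : I →ₗ[R] M), ∃ e : M, ∀ x : I, f x = (x : R) • e := by
  rw [← Module.Baer.iff_injective]
  refine forall₂_congr fun I f => ⟨?_, ?_⟩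
  · rintro ⟨g, hg⟩
    refine ⟨g 1, fun x => ?_⟩
    rw [← map_smul, smul_eq_mul, mul_one, hg x x.2]
  · rintro ⟨e, he⟩
    exact ⟨LinearMap.toSpanSingleton R M e, fun x hx => by simp [he ⟨x, hx⟩]⟩

theorem exists_extension {E : Type u} [AddCommGroup E] [Module R E] (hE : Module.Injective R E)
    {X Y : Type u} [AddCommGroup X] [AddCommGroup Y] [Module R X] [Module R Y]
    {j : X →ₗ[R] Y} (hj : Function.Injective j) (f : X →ₗ[R] E) :
    ∃ g : Y →ₗ[R] E, g ∘ₗ j = f := by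
  obtain ⟨g, hg⟩ := hE.out j hj f
  exact ⟨g, LinearMap.ext hg⟩

theorem injective_of_equiv {M N : Type u} [AddCommGroup M] [Module R M] [AddCommGroup N]
    [Module R N] (e : M ≃ₗ[R] N) (h : Module.Injective R M) : Module.Injective R N :=
  Module.Baer.iff_injective.1 ((Module.Baer.iff_injective.2 h).of_equiv e)

/-- If `N` embeds in the injective module `J` and `N' / N` embeds in `U`, then `N'` embeds in
`J × U` over `N`. -/
theorem exists_injective_extension_prod {N N' J U : Type u} [AddCommGroup N] [Module R N]
    [AddCommGroup N'] [Module R N'] [AddCommGroup J] [Module R J] [AddCommGroup U] [Module R U]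
    (hJ : Module.Injective R J) {j : N →ₗ[R] N'} (hj : Function.Injective j) {f : N →ₗ[R] J}
    (hf : Function.Injective f)
    {q : (N' ⧸ LinearMap.range j) →ₗ[R] U} (hq : Function.Injective q) :
    ∃ g : N' →ₗ[R] J × U, Function.Injective g ∧ g ∘ₗ j = LinearMap.inl R J U ∘ₗ f := by
  obtain ⟨g, hg⟩ := exists_extension hJ hj f
  -- `g` may have a kernel, but the second coordinate vanishes only on `N`, where `g` agrees with
  -- the injective `f`.
  refine ⟨g.prod (q ∘ₗ Submodule.mkQ _), ?_, ?_⟩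
  · rw [injective_iff_map_eq_zero]
    intro x hx
    have h1 : g x = 0 := congrArg Prod.fst hx
    have h2 : q (Submodule.mkQ _ x) = 0 := congrArg Prod.snd hx
    rw [map_eq_zero_iff q hq, Submodule.mkQ_apply, Submodule.Quotient.mk_eq_zero] at h2
    obtain ⟨y, rfl⟩ := h2
    have : f y = 0 := by rw [← hg]; exact h1
    rw [(map_eq_zero_iff f hf).1 this, map_zero]
  · ext x
    · exact LinearMap.congr_fun hg x
    · have : (Submodule.mkQ (LinearMap.range j)) (j x) = 0 := by simp
      simp [this]

/-- The quotients of one module form a set, so an injective module around their direct sum contains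
them all. Free modules `F` of large rank give all small modules; `F = R` gives all cyclic ones. -/
theorem exists_injective_embedding_quotients (F : Type u) [AddCommGroup F] [Module R F] :
    ∃ (E : Type u) (_ : AddCommGroup E) (_ : Module R E), Module.Injective R E ∧
      ∀ K : Submodule R F, ∃ f : F ⧸ K →ₗ[R] E, Function.Injective f := by
  classical
  obtain ⟨E, _, _, hE, h, hh⟩ := exists_injective_embedding (R := R)
    (DirectSum (Submodule R F) fun K => F ⧸ K)
  exact ⟨E, _, _, hE, fun K => ⟨h ∘ₗ DirectSum.lof R _ (fun K : Submodule R F => F ⧸ K) K,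
    hh.comp (DirectSum.of_injective _)⟩⟩

/-- A module in which every extension of size at most `χ` of a submodule is realized. -/
theorem exists_amalgamation_module (R : Type u) [Ring R] (χ : Cardinal.{u}) :
    ∃ (E : Type u) (_ : AddCommGroup E) (_ : Module R E),
      ∀ (N N' : Type u) [AddCommGroup N] [Module R N] [AddCommGroup N'] [Module R N']
        (i : N →ₗ[R] E) (j : N →ₗ[R] N'), Function.Injective i → Function.Injective j →
        #N' ≤ χ → ∃ g : N' →ₗ[R] E, Function.Injective g ∧ g ∘ₗ j = i := by
  classical
  obtain ⟨H, _, _, hH, hq⟩ := exists_injective_embedding_quotients (R := R) (χ.out →₀ R)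
  have hsmall : ∀ (N : Type u) [AddCommGroup N] [Module R N], #N ≤ χ →
      ∃ q : N →ₗ[R] H, Function.Injective q := by
    intro N _ _ hN
    obtain ⟨s, hs⟩ : ∃ s : χ.out → N, Function.Surjective s := by
      rw [← mk_out χ] at hN
      obtain ⟨f⟩ := hN
      exact ⟨Function.invFun f, Function.invFun_surjective f.injective⟩
    let p : (χ.out →₀ R) →ₗ[R] N := Finsupp.linearCombination R s
    have hp : Function.Surjective p := Finsupp.linearCombination_surjective R hs
    let e := p.quotKerEquivOfSurjective hp
    obtain ⟨h, hh⟩ := hq (LinearMap.ker p)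
    exact ⟨h ∘ₗ e.symm.toLinearMap, hh.comp e.symm.injective⟩
  -- With `χ⁺` coordinates and at most `χ` elements in `N'`, some coordinate is left free to carry a
  -- copy of `N'` modulo the image of `N`.
  let ι := (Order.succ χ).out
  refine ⟨ι → H, inferInstance, inferInstance, ?_⟩
  intro N N' _ _ _ _ i j hi hj hN'
  have hE : Module.Injective R (ι → H) := inferInstance
  obtain ⟨f, hf⟩ := exists_extension hE hj i
  obtain ⟨q, hq⟩ := hsmall (N' ⧸ LinearMap.range j)
    ((mk_le_of_surjective (Submodule.mkQ_surjective _)).trans hN')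
  -- some coordinate is not the support of an element of the range of `f`
  obtain ⟨t, ht⟩ : ∃ t : ι, ∀ x y, f x = Pi.single t y → y = 0 := by
    by_contra! hcon
    choose x y hxy hy using hcon
    have hx : Function.Injective x := by
      intro s t hst
      by_contra hne
      have h1 : (Pi.single s (y s) : ι → H) s = (Pi.single t (y t) : ι → H) s := by
        rw [← hxy, ← hxy, hst]
      rw [Pi.single_eq_same, Pi.single_eq_of_ne hne] at h1
      exact hy s h1
    have := (mk_le_of_injective hx).trans hN'
    rw [mk_out] at this
    exact absurd this (not_le.2 (Order.lt_succ χ))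
  refine ⟨f + LinearMap.single R (fun _ : ι => H) t ∘ₗ q ∘ₗ Submodule.mkQ _, ?_, ?_⟩
  · rw [injective_iff_map_eq_zero]
    intro x hx
    have h1 : f x = Pi.single t (- q (Submodule.mkQ _ x)) := by
      rw [Pi.single_neg]
      exact eq_neg_of_add_eq_zero_left hx
    have h2 : q (Submodule.mkQ _ x) = 0 := neg_eq_zero.1 (ht _ _ h1)
    rw [h2, neg_zero, Pi.single_zero] at h1
    rw [map_eq_zero_iff q hq, Submodule.mkQ_apply, Submodule.Quotient.mk_eq_zero] at h2
    obtain ⟨y, rfl⟩ := h2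
    have : i y = 0 := by rw [← hf]; exact h1
    rw [(map_eq_zero_iff i hi).1 this, map_zero]
  · rw [← hf]
    ext x : 1
    have : (Submodule.mkQ (LinearMap.range j)) (j x) = 0 := by simp
    simp [this]

end Injective

/-! ### Universal extensions and existence of limit models. -/

variable {R : Type u} [Ring R]

theorem UniversalOver.comp_equiv {N M N₁ M₁ : Type u} [AddCommGroup N] [Module R N]
    [AddCommGroup M] [Module R M] [AddCommGroup N₁] [Module R N₁] [AddCommGroup M₁] [Module R M₁]
    {i : N →ₗ[R] M} (hi : UniversalOver i) (e : N₁ ≃ₗ[R] N) (e' : M ≃ₗ[R] M₁) :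
    UniversalOver (e'.toLinearMap ∘ₗ i ∘ₗ e.toLinearMap) := by
  obtain ⟨h1, h2, h3⟩ := hi
  refine ⟨e'.injective.comp (h1.comp e.injective), ?_, ?_⟩
  · rw [← mk_congr e'.toEquiv, h2, mk_congr e.toEquiv]
  · intro N' _ _ j hj hN'
    obtain ⟨f, hf, hfj⟩ := h3 N' (j ∘ₗ e.symm.toLinearMap) (hj.comp e.symm.injective)
      (by rw [hN', mk_congr e.toEquiv])
    refine ⟨e'.toLinearMap ∘ₗ f, e'.injective.comp hf, ?_⟩
    ext x
    have := LinearMap.congr_fun hfj (e x)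
    simp only [LinearMap.comp_apply, LinearEquiv.coe_coe, LinearEquiv.symm_apply_apply] at this ⊢
    rw [this]

/-- `B` is universal over its submodule `A`, for submodules of a common module. -/
def UniversalBetween {E : Type u} [AddCommGroup E] [Module R E] (A B : Submodule R E) : Prop :=
  ∃ h : A ≤ B, UniversalOver (Submodule.inclusion h)

section Between

variable {E : Type u} [AddCommGroup E] [Module R E]

theorem UniversalOver.between {A : Submodule R E} {M : Type u} [AddCommGroup M] [Module R M]
    {i : A →ₗ[R] M} (hi : UniversalOver i) {g : M →ₗ[R] E} (hg : Function.Injective g)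
    (hgi : g ∘ₗ i = A.subtype) : UniversalBetween A (LinearMap.range g) := by
  have h : A ≤ LinearMap.range g := fun x hx => ⟨i ⟨x, hx⟩, LinearMap.congr_fun hgi ⟨x, hx⟩⟩
  refine ⟨h, ?_⟩
  have := hi.comp_equiv (LinearEquiv.refl R A) (LinearEquiv.ofInjective g hg)
  convert this using 1
  ext x
  exact (LinearMap.congr_fun hgi x).symm

theorem UniversalBetween.submoduleOf {A B : Submodule R E} (h : UniversalBetween A B)
    {S : Submodule R E} (hB : B ≤ S) : UniversalBetween (A.submoduleOf S) (B.submoduleOf S) := by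
  obtain ⟨hAB, h⟩ := h
  refine ⟨fun x hx => hAB hx, ?_⟩
  exact h.comp_equiv (Submodule.submoduleOfEquivOfLe (hAB.trans hB))
    (Submodule.submoduleOfEquivOfLe hB).symm

theorem isLimitModelOver_iSup {κ : Cardinal.{u}} {α : Ordinal.{u}} (hα : Order.IsSuccLimit α)
    {C : Ordinal.{u} → Submodule R E} (hmono : Monotone C)
    (hcont : ∀ i, Order.IsSuccLimit i → C i = ⨆ j : Set.Iio i, C j)
    (hcard : ∀ i < α, #(C i) = κ) (hU : ∀ i < α, UniversalBetween (C i) (C (i + 1))) :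
    IsLimitModelOver R κ α (⨆ i : Set.Iio α, C i : Submodule R E)
      ((C 0).submoduleOf (⨆ i : Set.Iio α, C i)) := by
  have hle : ∀ i < α, C i ≤ ⨆ i : Set.Iio α, C i := fun i hi =>
    le_iSup (fun j : Set.Iio α => C j) ⟨i, hi⟩
  have mem : ∀ i, Order.IsSuccLimit i → ∀ x, x ∈ (⨆ j : Set.Iio i, C j) → ∃ j < i, x ∈ C j :=
    fun i hi x hx => (mem_iSup_Iio hi.bot_lt fun j k h _ => hmono h).1 hx
  refine ⟨fun i => (C i).submoduleOf _, rfl, ?_, ?_, ?_, ?_, ?_⟩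
  · intro i hi
    rw [← hcard i hi]
    exact mk_congr (Submodule.submoduleOfEquivOfLe (hle i hi)).toEquiv
  · intro i j hij _ x hx
    exact hmono hij hx
  · intro j hj hjl x hx
    refine mem j hjl x ?_
    rw [← hcont j hjl]
    exact hx
  · intro i hi
    exact (hU i hi).submoduleOf (hle _ (hα.add_one_lt hi))
  · rintro ⟨x, hx⟩
    exact mem α hα x hx

end Between

/-- If universal extensions exist in cardinality `χ`, then so do limit models of all lengths. -/
theorem exists_isLimitModelOver [Nontrivial R] {χ : Cardinal.{u}} (hχ : ℵ₀ ≤ χ) (hR : #R ≤ χ)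
    (hU : ∀ (M : Type u) [AddCommGroup M] [Module R M], #M = χ →
      ∃ (M' : Type u) (_ : AddCommGroup M') (_ : Module R M') (i : M →ₗ[R] M'), UniversalOver i)
    {α : Ordinal.{u}} (hα : Order.IsSuccLimit α) (hαχ : α < (Order.succ χ).ord) :
    ∃ (M : Type u) (_ : AddCommGroup M) (_ : Module R M) (N : Submodule R M),
      IsLimitModelOver R χ α M N := by
  -- All stages are built as submodules of one `E`, so limit stages are suprema and no direct limits
  -- are needed.
  obtain ⟨E, _, _, hE⟩ := exists_amalgamation_module R χ
  have hinf : Infinite χ.out := by rw [infinite_iff, mk_out]; exact hχ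
  obtain ⟨g, hg, -⟩ := hE PUnit (χ.out →₀ R) 0 0 (Function.injective_of_subsingleton _)
    (Function.injective_of_subsingleton _) (mk_finsupp_le hχ (by simp) hR)
  obtain ⟨C, -, hmono, hcont, hP, hQ⟩ := exists_continuous_chain α
    (fun N : Submodule R E => #N = χ) UniversalBetween (LinearMap.range g)
    (by
      rw [← mk_congr (LinearEquiv.ofInjective g hg).toEquiv, mk_finsupp_of_infinite, mk_out]
      exact max_eq_left hR)
    (by
      intro N hN
      obtain ⟨M', _, _, i, hi⟩ := hU N hN
      have hM' := hi.2.1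
      obtain ⟨g, hg, hgi⟩ := hE N M' N.subtype i N.injective_subtype hi.1
        (by rw [hM', hN])
      have hb := hi.between hg hgi
      refine ⟨_, hb.1, ?_, hb⟩
      rw [← mk_congr (LinearEquiv.ofInjective g hg).toEquiv, hM', hN])
    (by
      intro i hi hil C hC hcard
      refine le_antisymm (mk_iSup_Iio_le hχ hil.bot_lt (hi.trans hαχ) (fun j k h _ => hC h)
        fun j hj => (hcard j hj).le) ?_
      rw [← hcard 0 hil.bot_lt]
      exact mk_le_of_injective (Submodule.inclusion_injective
        (le_iSup (fun j : Set.Iio i => C j) ⟨0, hil.bot_lt⟩)))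
  exact ⟨_, _, _, _, isLimitModelOver_iSup hα hmono hcont hP hQ⟩

/-- If there is a limit model of cardinality `χ ≥ |R|`, then every module of cardinality `χ` has a
universal extension. -/
theorem IsLimitModel.exists_universalOver {χ : Cardinal.{u}} {L : Type u}
    [AddCommGroup L] [Module R L] (hL : IsLimitModel R χ L) (M : Type u) [AddCommGroup M]
    [Module R M] (hM : #M = χ) :
    ∃ (M' : Type u) (_ : AddCommGroup M') (_ : Module R M') (i : M →ₗ[R] M'), UniversalOver i := by
  obtain ⟨hχ, α, hα, -, -, C, -, hcard, -, -, hU, -⟩ := hL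
  have h0 : 0 < α := hα.bot_lt
  have h1 := hα.add_one_lt h0
  obtain ⟨h01, -, hcard1, hU0⟩ := hU 0 h0
  obtain ⟨h12, hi12, hcard2, hU1⟩ := hU (0 + 1) h1
  have hc0 := hcard 0 h0
  have hc1 := hcard _ h1
  -- `M` embeds into `C 1`
  obtain ⟨f, hf, -⟩ := hU0 (M × C 0) (LinearMap.inr R M (C 0)) LinearMap.inr_injective (by
    rw [mk_prod, lift_id, lift_id, hM, hc0, mul_eq_self hχ])
  let i : M →ₗ[R] C (0 + 1) := f ∘ₗ LinearMap.inl R M (C 0)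
  have hi : Function.Injective i := hf.comp LinearMap.inl_injective
  -- `C 1` is only known to be universal over `C 0`. An extension of `M` is therefore amalgamated
  -- with `C 1` over `M`, and the result embeds in `C 2` over `C 1`.
  refine ⟨C (0 + 1 + 1), inferInstance, inferInstance, Submodule.inclusion h12 ∘ₗ i,
    hi12.comp hi, by rw [hcard2, hc1, hM], ?_⟩
  intro N' _ _ j hj hN'
  -- amalgamate `N'` and `C 1` over `M`
  obtain ⟨E, _, _, hE⟩ := exists_amalgamation_module R χ
  obtain ⟨g, hg, -⟩ := hE PUnit (C (0 + 1)) 0 0 (Function.injective_of_subsingleton _)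
    (Function.injective_of_subsingleton _) hc1.le
  obtain ⟨k, hk, hkj⟩ := hE M N' (g ∘ₗ i) j (hg.comp hi) hj (by rw [hN', hM])
  let P := LinearMap.range g ⊔ LinearMap.range k
  have hgP : ∀ x, g x ∈ P := fun x => Submodule.mem_sup_left ⟨x, rfl⟩
  have hkP : ∀ x, k x ∈ P := fun x => Submodule.mem_sup_right ⟨x, rfl⟩
  have hginj : Function.Injective (g.codRestrict P hgP) :=
    fun x y h => hg (congrArg Subtype.val h)
  have hkinj : Function.Injective (k.codRestrict P hkP) :=
    fun x y h => hk (congrArg Subtype.val h)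
  obtain ⟨l, hl, hlg⟩ := hU1 P (g.codRestrict P hgP) hginj (by
    refine le_antisymm ?_ (mk_le_of_injective hginj)
    rw [hc1]
    refine mk_sup_le hχ ?_ ?_
    · rw [← mk_congr (LinearEquiv.ofInjective g hg).toEquiv, hc1]
    · rw [← mk_congr (LinearEquiv.ofInjective k hk).toEquiv, hN', hM])
  refine ⟨l ∘ₗ k.codRestrict P hkP, hl.comp hkinj, ?_⟩
  rw [← hlg, LinearMap.comp_assoc, LinearMap.comp_assoc]
  congr 1
  ext x
  exact LinearMap.congr_fun hkj x

/-! ### Injectivity of limit models. -/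

section InjectiveLimit

variable {κ : Cardinal.{u}} {α : Ordinal.{u}} {M : Type u} [AddCommGroup M] [Module R M]
  {N : Submodule R M}

/-- A limit model is injective as soon as every map from a left ideal into it is bounded in the
chain. -/
theorem IsLimitModelOver.injective_of_bounded (hκ : ℵ₀ ≤ κ) (hR : #R ≤ κ)
    (hM : IsLimitModelOver R κ α M N)
    (hb : ∀ C : Ordinal.{u} → Submodule R M, (∀ i j, i ≤ j → j < α → C i ≤ C j) →
      (∀ x : M, ∃ i < α, x ∈ C i) → ∀ (I : Ideal R) (f : I →ₗ[R] M), ∃ i < α, ∀ x, f x ∈ C i) :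
    Module.Injective R M := by
  obtain ⟨C, -, hcard, hmono, -, hU, hex⟩ := hM
  rw [injective_iff_exists_smul]
  intro I f
  obtain ⟨i, hi, hfi⟩ := hb C hmono hex I f
  obtain ⟨E, _, _, hE, g, hg⟩ := exists_injective_embedding (R := R) (C i)
  obtain ⟨e, he⟩ := injective_iff_exists_smul.1 hE I (g ∘ₗ f.codRestrict (C i) hfi)
  -- Adding the single solution `e` to `C i` keeps the cardinality `κ`, so universality brings `e`
  -- into `C (i + 1)`.
  let P := LinearMap.range g ⊔ Submodule.span R {e}
  have hgP : ∀ x, g x ∈ P := fun x => Submodule.mem_sup_left ⟨x, rfl⟩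
  have heP : e ∈ P := Submodule.mem_sup_right (Submodule.mem_span_singleton_self e)
  have hginj : Function.Injective (g.codRestrict P hgP) :=
    fun x y h => hg (congrArg Subtype.val h)
  obtain ⟨_, -, -, hU⟩ := hU i hi
  obtain ⟨l, hl, hlg⟩ := hU P (g.codRestrict P hgP) hginj (by
    refine le_antisymm ?_ (mk_le_of_injective hginj)
    rw [hcard i hi]
    refine mk_sup_le hκ ?_ (mk_span_le hκ hR ?_)
    · rw [← mk_congr (LinearEquiv.ofInjective g hg).toEquiv, hcard i hi]
    · rw [mk_singleton]; exact one_le_aleph0.trans hκ)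
  refine ⟨l ⟨e, heP⟩, fun x => ?_⟩
  have h1 : (x : R) • (⟨e, heP⟩ : P) = g.codRestrict P hgP ⟨f x, hfi x⟩ :=
    Subtype.ext (he x).symm
  rw [← Submodule.coe_smul, ← map_smul, h1]
  exact (congrArg Subtype.val (LinearMap.congr_fun hlg ⟨f x, hfi x⟩)).symm

theorem bounded_of_lt_cof (hα : #R < α.cof) {C : Ordinal.{u} → Submodule R M}
    (hmono : ∀ i j, i ≤ j → j < α → C i ≤ C j) {I : Ideal R} {f : I →ₗ[R] M}
    (hex : ∀ x, ∃ i < α, f x ∈ C i) : ∃ i < α, ∀ x, f x ∈ C i := by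
  choose i hi hfi using hex
  have hlt : ⨆ x, i x < α :=
    Ordinal.iSup_lt_of_lt_cof ((mk_le_of_injective Subtype.val_injective).trans_lt hα) hi
  exact ⟨_, hlt, fun x => hmono _ _ (Ordinal.le_iSup i x) hlt (hfi x)⟩

theorem bounded_of_isNoetherianRing [IsNoetherianRing R] (hα : 0 < α)
    {C : Ordinal.{u} → Submodule R M}
    (hmono : ∀ i j, i ≤ j → j < α → C i ≤ C j) {I : Ideal R} {f : I →ₗ[R] M}
    (hex : ∀ x, ∃ i < α, f x ∈ C i) : ∃ i < α, ∀ x, f x ∈ C i := by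
  have hfg : (LinearMap.range f).FG := by
    rw [LinearMap.range_eq_map]
    exact (IsNoetherian.noetherian (⊤ : Submodule R I)).map f
  obtain ⟨s, hs⟩ := hfg
  have hs' : ∀ x ∈ s, ∃ i < α, x ∈ C i := by
    intro x hx
    obtain ⟨y, rfl⟩ : x ∈ LinearMap.range f := hs ▸ Submodule.subset_span hx
    exact hex y
  obtain ⟨i, hi, hsi⟩ : ∃ i < α, ∀ x ∈ s, x ∈ C i := by
    clear hs
    classical
    induction s using Finset.induction_on with
    | empty => exact ⟨0, hα, by simp⟩
    | insert a s _ ih =>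
      obtain ⟨i, hi, h⟩ := ih fun x hx => hs' x (Finset.mem_insert_of_mem hx)
      obtain ⟨j, hj, h'⟩ := hs' a (Finset.mem_insert_self a s)
      refine ⟨max i j, max_lt hi hj, fun x hx => ?_⟩
      rcases Finset.mem_insert.1 hx with rfl | hx
      · exact hmono _ _ (le_max_right i j) (max_lt hi hj) h'
      · exact hmono _ _ (le_max_left i j) (max_lt hi hj) (h x hx)
  refine ⟨i, hi, fun x => ?_⟩
  have : LinearMap.range f ≤ C i := by rw [← hs]; exact Submodule.span_le.2 hsi
  exact this ⟨x, rfl⟩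

theorem IsLimitModelOver.injective_of_lt_cof (hκ : ℵ₀ ≤ κ) (hR : #R ≤ κ) (hα : #R < α.cof)
    (hM : IsLimitModelOver R κ α M N) : Module.Injective R M :=
  hM.injective_of_bounded hκ hR fun _ hmono hex _ _ => bounded_of_lt_cof hα hmono fun _ => hex _

theorem IsLimitModelOver.injective_of_isNoetherianRing [IsNoetherianRing R] (hκ : ℵ₀ ≤ κ)
    (hR : #R ≤ κ) (hα : Order.IsSuccLimit α)
    (hM : IsLimitModelOver R κ α M N) : Module.Injective R M :=
  hM.injective_of_bounded hκ hR fun _ hmono hex _ _ =>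
    bounded_of_isNoetherianRing hα.bot_lt hmono fun _ => hex _

end InjectiveLimit

/-! ### Small injective submodules. -/

variable {R : Type u} [Ring R]

/-- Submodules of size at most `κ` of injective modules lie in injective submodules of size at most
`κ`, and `κ` bounds the ring and its lattice of left ideals. -/
structure HasSmallInjectives (R : Type u) [Ring R] (κ : Cardinal.{u}) : Prop where
  aleph0_le : ℵ₀ ≤ κ
  mk_ring_le : #R ≤ κ
  mk_ideal_le : #(Ideal R) ≤ κ
  exists_le : ∀ (E : Type u) [AddCommGroup E] [Module R E], Module.Injective R E →
    ∀ A : Submodule R E, #A ≤ κ → ∃ B : Submodule R E, A ≤ B ∧ #B ≤ κ ∧ Module.Injective R B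

/-- Close `A` off `α` times, each time adding a solution in `E` for every map from a left ideal to
the current stage. A map into the union is bounded, hence solved one stage later, and Baer's
criterion applies. The counting hypotheses keep the stages small. -/
theorem HasSmallInjectives.of_bounded {κ : Cardinal.{u}} (hκ : ℵ₀ ≤ κ) (hR : #R ≤ κ)
    (hI : #(Ideal R) ≤ κ) (hhom : ∀ (I : Ideal R) (N : Type u) [AddCommGroup N] [Module R N],
      #N ≤ κ → #(I →ₗ[R] N) ≤ κ)
    {α : Ordinal.{u}} (hα : Order.IsSuccLimit α) (hακ : α < (Order.succ κ).ord)
    (hb : ∀ (M : Type u) [AddCommGroup M] [Module R M] (C : Ordinal.{u} → Submodule R M),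
      Monotone C → ∀ (I : Ideal R) (f : I →ₗ[R] M), (∀ x, ∃ i < α, f x ∈ C i) →
        ∃ i < α, ∀ x, f x ∈ C i) :
    HasSmallInjectives R κ := by
  refine ⟨hκ, hR, hI, fun E _ _ hE A hA => ?_⟩
  obtain ⟨C, h0, hmono, -, hP, hQ⟩ := exists_continuous_chain α
    (fun N : Submodule R E => #N ≤ κ)
    (fun N N' => ∀ (I : Ideal R) (f : I →ₗ[R] N), ∃ e ∈ N', ∀ x : I, (f x : E) = (x : R) • e)
    A hA
    (by
      intro N hN
      have hex : ∀ p : Σ I : Ideal R, (I →ₗ[R] N), ∃ e : E, ∀ x : p.1, (p.2 x : E) = (x : R) • e :=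
        fun p => injective_iff_exists_smul.1 hE p.1 (N.subtype ∘ₗ p.2)
      choose e he using hex
      refine ⟨N ⊔ Submodule.span R (Set.range e), le_sup_left, ?_,
        fun I f => ⟨e ⟨I, f⟩, ?_, he ⟨I, f⟩⟩⟩
      · refine mk_sup_le hκ hN (mk_span_le hκ hR (mk_range_le.trans ?_))
        rw [mk_sigma]
        exact (sum_le_mk_mul_iSup _).trans
          (mul_le_of_le hκ hI (ciSup_le' fun I => hhom I N hN))
      · exact Submodule.mem_sup_right (Submodule.subset_span ⟨_, rfl⟩))
    (fun i hi hil C hC hcard =>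
      mk_iSup_Iio_le hκ hil.bot_lt (hi.trans hακ) (fun j k h _ => hC h) hcard)
  have hle : ∀ i < α, C i ≤ ⨆ j : Set.Iio α, C j := fun i hi =>
    le_iSup (fun j : Set.Iio α => C j) ⟨i, hi⟩
  have hmem : ∀ x, x ∈ (⨆ j : Set.Iio α, C j) ↔ ∃ i < α, x ∈ C i := fun x =>
    mem_iSup_Iio hα.bot_lt fun j k h _ => hmono h
  refine ⟨⨆ j : Set.Iio α, C j, h0 ▸ hle 0 hα.bot_lt,
    mk_iSup_Iio_le hκ hα.bot_lt hακ (fun j k h _ => hmono h) hP, ?_⟩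
  rw [injective_iff_exists_smul]
  intro I f
  obtain ⟨i, hi, hfi⟩ := hb E C hmono I (Submodule.subtype _ ∘ₗ f) fun x => (hmem _).1 (f x).2
  obtain ⟨e, he, h⟩ := hQ i hi I ((Submodule.subtype _ ∘ₗ f).codRestrict (C i) hfi)
  exact ⟨⟨e, hle _ (hα.add_one_lt hi) he⟩, fun x => Subtype.ext (h x)⟩

theorem HasSmallInjectives.of_isNoetherianRing [IsNoetherianRing R] {κ : Cardinal.{u}}
    (hκ : #R + ℵ₀ ≤ κ) : HasSmallInjectives R κ := by
  have hκ0 : ℵ₀ ≤ κ := le_add_self.trans hκ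
  have hR : #R ≤ κ := le_self_add.trans hκ
  refine .of_bounded hκ0 hR ?_ ?_ Ordinal.isSuccLimit_omega0 (lt_ord.2 ?_) ?_
  · have hs : Function.Surjective fun l : List R => (Submodule.span R {x | x ∈ l} : Ideal R) := by
      intro I
      obtain ⟨s, hs⟩ := IsNoetherian.noetherian I
      refine ⟨s.toList, ?_⟩
      simpa using hs
    exact (mk_le_of_surjective hs).trans ((mk_list_le_max R).trans (max_le hκ0 hR))
  · intro I N _ _ hN
    obtain ⟨s, hs⟩ := IsNoetherian.noetherian (⊤ : Submodule R I)
    have hinj : Function.Injective fun (f : I →ₗ[R] N) (x : s) => f x := by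
      intro f g hfg
      refine LinearMap.ext_on hs fun x hx => ?_
      exact congrFun hfg ⟨x, hx⟩
    refine (mk_le_of_injective hinj).trans ?_
    rw [← power_def, mk_fintype s]
    exact (power_le_power_right hN).trans (power_nat_le hκ0)
  · rw [Ordinal.card_omega0]
    exact Order.lt_succ_of_le hκ0
  · intro M _ _ C hC I f h
    exact bounded_of_isNoetherianRing Ordinal.omega0_pos (fun i j h _ => hC h) h

/-- For an arbitrary ring, closing off `(#R + ℵ₀)⁺` times suffices since this length has cofinality
above `#R`. At this cardinal, universal extensions therefore exist before `R` is known to be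
noetherian. -/
theorem HasSmallInjectives.two_power (R : Type u) [Ring R] :
    HasSmallInjectives R (2 ^ (#R + ℵ₀)) := by
  have hμ : #R + ℵ₀ < 2 ^ (#R + ℵ₀) := cantor _
  have hμ0 : ℵ₀ ≤ #R + ℵ₀ := le_add_self
  have hR : #R ≤ #R + ℵ₀ := le_self_add
  have hreg := isRegular_succ hμ0
  refine .of_bounded (hμ0.trans hμ.le) (hR.trans hμ.le) ?_ ?_
    (isSuccLimit_ord hreg.aleph0_le)
    (ord_lt_ord.2 (Order.lt_succ_of_le (Order.succ_le_of_lt hμ))) ?_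
  · refine (mk_le_of_injective (SetLike.coe_injective : Function.Injective
      fun I : Ideal R => (I : Set R))).trans ?_
    rw [mk_set]
    exact power_le_power_left two_ne_zero hR
  · intro I N _ _ hN
    refine (mk_le_of_injective (DFunLike.coe_injective : Function.Injective
      fun (f : I →ₗ[R] N) => (f : I → N))).trans ?_
    rw [← power_def]
    refine (power_le_power_right hN).trans ?_
    rw [← power_mul]
    refine power_le_power_left two_ne_zero (mul_le_of_le hμ0 le_rfl ?_)
    exact (mk_le_of_injective Subtype.val_injective).trans hR
  · intro M _ _ C hC I f h
    refine bounded_of_lt_cof ?_ (fun i j h _ => hC h) h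
    rw [hreg.cof_ord]
    exact Order.lt_succ_of_le hR

/-! ### Universal injective modules and universal extensions. -/

section Universal

theorem sSupIndep_insert {L : Type*} [CompleteLattice L] [IsModularLattice L] {S : Set L}
    (hS : sSupIndep S) {P : L} (hP : Disjoint P (sSup S)) : sSupIndep (insert P S) := by
  intro a ha
  rcases ha with rfl | ha
  · exact hP.mono_right (sSup_le_sSup (by simp))
  · have h1 : Disjoint a (sSup (S \ {a}) ⊔ P) :=
      (hS ha).disjoint_sup_right_of_disjoint_sup_left
        (hP.symm.mono_left (sup_le (le_sSup ha) (sSup_le_sSup Set.sdiff_subset)))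
    refine h1.mono_right (sSup_le ?_)
    rintro b ⟨rfl | hb, hba⟩
    · exact le_sup_right
    · exact le_sup_of_le_left (le_sSup ⟨hb, hba⟩)

/-- Every module has an essential submodule that is a direct sum of cyclic modules. -/
theorem exists_independent_cyclic (N : Type u) [AddCommGroup N] [Module R N] :
    ∃ S : Set (Submodule R N), sSupIndep S ∧ (∀ P ∈ S, ∃ x : N, x ≠ 0 ∧ P = Submodule.span R {x}) ∧
      ∀ x : N, x ≠ 0 → ¬ Disjoint (Submodule.span R {x}) (sSup S) := by
  obtain ⟨S, hS⟩ := zorn_subset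
    {S : Set (Submodule R N) | sSupIndep S ∧ ∀ P ∈ S, ∃ x : N, x ≠ 0 ∧ P = Submodule.span R {x}}
    (by
      intro c hc hchain
      refine ⟨⋃₀ c, ⟨iSupIndep_sUnion_of_directed hchain.directedOn fun s hs => (hc hs).1, ?_⟩,
        fun s hs => Set.subset_sUnion_of_mem hs⟩
      rintro P ⟨s, hs, hP⟩
      exact (hc hs).2 P hP)
  refine ⟨S, hS.1.1, hS.1.2, fun x hx hdis => ?_⟩
  have hmem : Submodule.span R {x} ∈ S := by
    refine hS.2 (y := insert (Submodule.span R {x}) S) ⟨sSupIndep_insert hS.1.1 hdis, ?_⟩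
      (Set.subset_insert _ _) (Set.mem_insert _ _)
    rintro P (rfl | hP)
    · exact ⟨x, hx, rfl⟩
    · exact hS.1.2 P hP
  have := hdis.mono_right (le_sSup hmem)
  rw [disjoint_self, Submodule.span_singleton_eq_bot] at this
  exact hx this

/-- `R x` is `R` modulo the annihilator of `x`. The last clause keeps the image inside the submodule
generated by the class of `1`, so it survives the passage to a small submodule. -/
theorem exists_embedding_span_singleton {N J : Type u} [AddCommGroup N] [Module R N]
    [AddCommGroup J] [Module R J] {q : ∀ K : Submodule R R, (R ⧸ K) →ₗ[R] J}
    (hq : ∀ K, Function.Injective (q K)) (x : N) :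
    ∃ (K : Submodule R R) (a : Submodule.span R {x} →ₗ[R] J), Function.Injective a ∧
      ∀ p, ∃ r : R, a p = r • q K (Submodule.Quotient.mk 1) := by
  let φ := LinearMap.toSpanSingleton R N x
  let e := φ.quotKerEquivRange
  have hr : Submodule.span R {x} = LinearMap.range φ := (LinearMap.range_toSpanSingleton x).symm
  let e' := LinearEquiv.ofEq _ _ hr
  refine ⟨LinearMap.ker φ, q _ ∘ₗ e.symm.toLinearMap ∘ₗ e'.toLinearMap,
    (hq _).comp (e.symm.injective.comp e'.injective), fun p => ?_⟩
  obtain ⟨r, hr⟩ := Submodule.Quotient.mk_surjective _ (e.symm (e' p))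
  refine ⟨r, ?_⟩
  rw [← map_smul, ← Submodule.Quotient.mk_smul, smul_eq_mul, mul_one, hr]
  rfl

/-- `U` is an injective module of cardinality `κ` containing all modules of size at most `κ`. -/
structure IsUniversalInjective (R : Type u) [Ring R] (κ : Cardinal.{u}) (U : Type u)
    [AddCommGroup U] [Module R U] : Prop where
  injective : Module.Injective R U
  mk_le : #U ≤ κ
  exists_embedding : ∀ (N : Type u) [AddCommGroup N] [Module R N], #N ≤ κ →
    ∃ f : N →ₗ[R] U, Function.Injective f

/-- `U` is a small injective module containing `κ` independent copies of every cyclic module. A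
module `N` of size at most `κ` has an essential direct sum of cyclic submodules, which embeds in
`U`. Extend this embedding to `N`: its kernel misses an essential submodule, hence is zero. -/
theorem HasSmallInjectives.exists_isUniversalInjective {κ : Cardinal.{u}}
    (h : HasSmallInjectives R κ) :
    ∃ (U : Type u) (_ : AddCommGroup U) (_ : Module R U), IsUniversalInjective R κ U := by
  classical
  obtain ⟨J, _, _, -, hq⟩ := exists_injective_embedding_quotients (R := R) R
  choose q hq using hq
  obtain ⟨E, _, _, hE, g, hg⟩ := exists_injective_embedding (R := R) (κ.out →₀ J)
  let a : κ.out × Ideal R → E := fun p => g (Finsupp.single p.1 (q p.2 (Submodule.Quotient.mk 1)))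
  obtain ⟨U, hAU, hU, hUinj⟩ := h.exists_le E hE (Submodule.span R (Set.range a))
    (mk_span_le h.aleph0_le h.mk_ring_le (mk_range_le.trans
      (mk_prod_le h.aleph0_le (mk_out κ).le h.mk_ideal_le)))
  refine ⟨U, inferInstance, inferInstance, hUinj, hU, fun N _ _ hN => ?_⟩
  obtain ⟨S, hS, hcyc, hess⟩ := exists_independent_cyclic (R := R) N
  -- the members of `S` are indexed by distinct elements of `κ`
  obtain ⟨t, ht⟩ : ∃ t : S → κ.out, Function.Injective t := by
    choose x hx hPx using fun P : S => hcyc P P.2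
    have hxinj : Function.Injective x := fun P Q hPQ =>
      Subtype.ext (by rw [hPx P, hPx Q, hPQ])
    have := (mk_le_of_injective hxinj).trans hN
    rw [← mk_out κ] at this
    obtain ⟨t⟩ := this
    exact ⟨t, t.injective⟩
  have hemb : ∀ P : S, ∃ (K : Submodule R R) (b : (P : Submodule R N) →ₗ[R] J),
      Function.Injective b ∧ ∀ p, ∃ r : R, b p = r • q K (Submodule.Quotient.mk 1) := by
    rintro ⟨P, hP⟩
    obtain ⟨x, -, rfl⟩ := hcyc P hP
    exact exists_embedding_span_singleton hq x
  choose K b hb hbq using hemb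
  let φ : (Π₀ P : S, (P : Submodule R N)) →ₗ[R] N :=
    DFinsupp.lsum ℕ fun P : S => (P : Submodule R N).subtype
  have hφ : Function.Injective φ := ((sSupIndep_iff S).1 hS).dfinsupp_lsum_injective
  let ψ : (Π₀ P : S, (P : Submodule R N)) →ₗ[R] (κ.out →₀ J) :=
    DFinsupp.lsum ℕ fun P : S => Finsupp.lsingle (t P) ∘ₗ b P
  have hψP : ∀ P d, ψ d (t P) = b P (d P) := by
    intro P d
    have : Finsupp.lapply (t P) ∘ₗ ψ = b P ∘ₗ DFinsupp.lapply P := by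
      ext Q x
      by_cases hQ : Q = P
      · subst hQ
        simp [ψ]
      · have h2 : (DFinsupp.single Q x : Π₀ P : S, (P : Submodule R N)) P = 0 :=
          DFinsupp.single_eq_of_ne (Ne.symm hQ)
        simp [ψ, ht.eq_iff, hQ, h2]
    exact LinearMap.congr_fun this d
  have hψ : Function.Injective ψ := by
    intro d d' hd
    ext P : 1
    apply hb P
    rw [← hψP, ← hψP, hd]
  have hψU : ∀ d, g (ψ d) ∈ U := by
    intro d
    induction d using DFinsupp.induction with
    | h0 => simp
    | ha P p f _ _ ih =>
      rw [map_add, map_add]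
      refine U.add_mem ?_ ih
      obtain ⟨r, hr⟩ := hbq P p
      have : g (ψ (DFinsupp.single P p)) = r • a (t P, K P) := by
        have h1 : ψ (DFinsupp.single P p) = Finsupp.single (t P) (b P p) := by simp [ψ]
        rw [h1, hr, ← Finsupp.smul_single, map_smul]
      rw [this]
      exact U.smul_mem r (hAU (Submodule.subset_span ⟨_, rfl⟩))
  obtain ⟨l, hl⟩ := exists_extension hUinj hφ ((g ∘ₗ ψ).codRestrict U hψU)
  refine ⟨l, ?_⟩
  rw [injective_iff_map_eq_zero]
  intro x hx
  by_contra hne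
  apply hess x hne
  rw [Submodule.disjoint_def]
  intro y hy hyS
  obtain ⟨r, rfl⟩ := Submodule.mem_span_singleton.1 hy
  rw [sSup_eq_iSup', Submodule.iSup_eq_range_dfinsupp_lsum] at hyS
  obtain ⟨d, hd⟩ := hyS
  have h1 : l (φ d) = 0 := by
    have : φ d = r • x := hd
    rw [this, map_smul, hx, smul_zero]
  have h2 : g (ψ d) = 0 := by
    rw [← LinearMap.comp_apply, hl] at h1
    exact congrArg Subtype.val h1
  rw [map_eq_zero_iff g hg, map_eq_zero_iff ψ hψ] at h2
  rw [← hd, h2, map_zero]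

theorem IsUniversalInjective.mk_eq [Nontrivial R] {κ : Cardinal.{u}} {U : Type u} [AddCommGroup U]
    [Module R U] (h : IsUniversalInjective R κ U) (hκ : ℵ₀ ≤ κ) (hR : #R ≤ κ) : #U = κ := by
  have hinf : Infinite κ.out := by rw [infinite_iff, mk_out]; exact hκ
  obtain ⟨f, hf⟩ := h.exists_embedding (κ.out →₀ R) (mk_finsupp_le hκ (mk_out κ).le hR)
  refine le_antisymm h.mk_le ?_
  have := mk_le_of_injective hf
  rw [mk_finsupp_of_infinite, mk_out] at this
  exact (le_max_left _ _).trans this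

theorem HasSmallInjectives.exists_injective_embedding {κ : Cardinal.{u}}
    (h : HasSmallInjectives R κ) (M : Type u) [AddCommGroup M] [Module R M] (hM : #M ≤ κ) :
    ∃ (J : Type u) (_ : AddCommGroup J) (_ : Module R J), Module.Injective R J ∧ #J ≤ κ ∧
      ∃ f : M →ₗ[R] J, Function.Injective f := by
  obtain ⟨E, _, _, hE, g, hg⟩ := ModEmb.exists_injective_embedding (R := R) M
  obtain ⟨B, hB, hBκ, hBinj⟩ := h.exists_le E hE (LinearMap.range g)
    (by rwa [← mk_congr (LinearEquiv.ofInjective g hg).toEquiv])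
  exact ⟨B, _, _, hBinj, hBκ, g.codRestrict B fun x => hB ⟨x, rfl⟩,
    fun x y hxy => hg (congrArg Subtype.val hxy)⟩

/-- Every module of cardinality `κ` has a universal extension. -/
theorem HasSmallInjectives.exists_universalOver {κ : Cardinal.{u}} (h : HasSmallInjectives R κ)
    (M : Type u) [AddCommGroup M] [Module R M] (hM : #M = κ) :
    ∃ (M' : Type u) (_ : AddCommGroup M') (_ : Module R M') (i : M →ₗ[R] M'), UniversalOver i := by
  obtain ⟨U, _, _, hU⟩ := h.exists_isUniversalInjective
  obtain ⟨J, _, _, hJ, hJκ, f, hf⟩ := h.exists_injective_embedding M hM.le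
  refine ⟨J × U, inferInstance, inferInstance, LinearMap.inl R J U ∘ₗ f,
    (LinearMap.inl_injective (R := R)).comp hf, ?_, ?_⟩
  · refine le_antisymm ?_ (mk_le_of_injective ((LinearMap.inl_injective (R := R)).comp hf))
    rw [hM]
    exact mk_prod_le h.aleph0_le hJκ hU.mk_le
  · intro N' _ _ j hj hN'
    obtain ⟨q, hq⟩ := hU.exists_embedding (N' ⧸ LinearMap.range j)
      ((mk_le_of_surjective (Submodule.mkQ_surjective _)).trans (hN'.trans hM).le)
    exact exists_injective_extension_prod hJ hj hf hq

end Universal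

variable {R : Type u} [Ring R]

/-! ### Non-stabilizing chains of left ideals and their diagonal map. -/

section Chains

theorem isNoetherianRing_of_not_exists_chain
    (h : ∀ I : ℕ → Ideal R, Monotone I → (∀ n, ∃ m, ¬ I m ≤ I n) → False) :
    IsNoetherianRing R := by
  rw [isNoetherianRing_iff, ← monotone_stabilizes_iff_noetherian]
  intro I
  by_contra! hI
  refine h I I.monotone fun n => ?_
  obtain ⟨m, hnm, hm⟩ := hI n
  exact ⟨m, fun hle => hm (le_antisymm (I.monotone hnm) hle)⟩

/-- The elements almost all of whose classes in the quotients by `I n` vanish. -/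
noncomputable def eventualIdeal (I : ℕ → Ideal R) : Ideal R :=
  (LinearMap.range (DFinsupp.coeFnLinearMap R (β := fun n => R ⧸ I n))).comap
    (LinearMap.pi fun n => Submodule.mkQ (I n))

theorem mem_eventualIdeal {I : ℕ → Ideal R} (hI : Monotone I) {n : ℕ} {r : R} (hr : r ∈ I n) :
    r ∈ eventualIdeal I := by
  classical
  refine ⟨DFinsupp.mk (Finset.range n) fun i => Submodule.Quotient.mk r, ?_⟩
  ext i
  by_cases hi : i < n
  · simp [hi]
  · have : r ∈ I i := hI (not_lt.1 hi) hr
    simp [hi, (Submodule.Quotient.mk_eq_zero (I i)).2 this]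

/-- The diagonal map into the direct sum of the quotients by `I n`. -/
theorem exists_diagonal (I : ℕ → Ideal R) :
    ∃ h : eventualIdeal I →ₗ[R] Π₀ n, R ⧸ I n,
      ∀ (r : eventualIdeal I) n, h r n = Submodule.Quotient.mk (r : R) := by
  have hinj : Function.Injective (DFinsupp.coeFnLinearMap R (β := fun n => R ⧸ I n)) :=
    DFunLike.coe_injective
  let e := LinearEquiv.ofInjective _ hinj
  refine ⟨e.symm.toLinearMap ∘ₗ
    ((LinearMap.pi fun n => Submodule.mkQ (I n)).restrict fun r (hr : r ∈ eventualIdeal I) => hr),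
    fun r n => ?_⟩
  have := congrArg Subtype.val (e.apply_symm_apply
    (((LinearMap.pi fun n => Submodule.mkQ (I n)).restrict
      fun r (hr : r ∈ eventualIdeal I) => hr) r))
  exact congrFun this n

end Chains

/-- An injective limit model of length `ω` forces the ring to be left noetherian. -/
theorem IsLimitModelOver.isNoetherianRing {κ : Cardinal.{u}} (hκ : ℵ₀ ≤ κ) (hR : #R ≤ κ)
    {M : Type u} [AddCommGroup M] [Module R M] {N : Submodule R M}
    (hM : IsLimitModelOver R κ Ordinal.omega0 M N) (hinj : Module.Injective R M) :
    IsNoetherianRing R := by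
  classical
  obtain ⟨C, -, hcard, hmono, -, hU, hex⟩ := hM
  refine isNoetherianRing_of_not_exists_chain fun I hI hne => ?_
  have hω : ∀ n : ℕ, (n : Ordinal.{u}) < Ordinal.omega0 := Ordinal.natCast_lt_omega0
  let D : ℕ → Submodule R M := fun n => C n
  have hD : Monotone D := fun m n h => hmono _ _ (by exact_mod_cast h) (hω n)
  -- The extension `C n × (R ⧸ I n)` embeds in `C (n + 1)` over `C n`, which puts the second factor
  -- off `C n`.
  have hg : ∀ n : ℕ, ∃ g : R ⧸ I n →ₗ[R] M, (∀ x, g x ∈ D (n + 1)) ∧ ∀ x, g x ∈ D n → x = 0 := by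
    intro n
    obtain ⟨hle, -, -, hU⟩ := hU n (hω n)
    obtain ⟨f, hf, hfi⟩ := hU (C n × (R ⧸ I n)) (LinearMap.inl R _ _) LinearMap.inl_injective (by
      refine le_antisymm ?_ (mk_le_of_injective (LinearMap.inl_injective (R := R)))
      rw [hcard n (hω n)]
      exact mk_prod_le hκ (hcard n (hω n)).le
        ((mk_le_of_surjective (Submodule.mkQ_surjective _)).trans hR))
    refine ⟨Submodule.subtype _ ∘ₗ f ∘ₗ LinearMap.inr R _ _, fun x => ?_, fun x hx => ?_⟩
    · have : D (n + 1) = C (n + 1 : Ordinal.{u}) := by simp [D]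
      rw [this]
      exact (f (0, x)).2
    · have h1 : f (⟨_, hx⟩, 0) = f (0, x) := Subtype.ext
        (congrArg Subtype.val (LinearMap.congr_fun hfi ⟨_, hx⟩))
      exact (congrArg Prod.snd (hf h1)).symm
  choose g hgD hg0 using hg
  let G : (Π₀ n, R ⧸ I n) →ₗ[R] M := DFinsupp.lsum ℕ g
  -- At the largest index `n` of the support, all other terms lie in `D n`. If `G d` does too, so
  -- does the top term, which must then vanish.
  have key : ∀ (d : Π₀ n, R ⧸ I n) (k : ℕ), G d ∈ D k → ∀ n, k ≤ n → d n = 0 := by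
    intro d k hd
    by_contra! hcon
    obtain ⟨n₀, hn₀, hdn₀⟩ := hcon
    obtain ⟨n, hn, hmax⟩ := d.support.exists_max_image id ⟨n₀, by simpa using hdn₀⟩
    have hkn : k ≤ n := hn₀.trans (hmax n₀ (by simpa using hdn₀))
    have hsum : G d = ∑ i ∈ d.support, g i (d i) := by
      simp [G, DFinsupp.lsum_apply_apply, DFinsupp.sumAddHom_apply, DFinsupp.sum]
    rw [← Finset.add_sum_erase _ _ hn] at hsum
    have hrest : ∑ i ∈ d.support.erase n, g i (d i) ∈ D n := by
      refine Submodule.sum_mem _ fun i hi => hD ?_ (hgD i (d i))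
      exact Nat.succ_le_of_lt (lt_of_le_of_ne (hmax i (Finset.mem_of_mem_erase hi))
        (Finset.ne_of_mem_erase hi))
    have : g n (d n) ∈ D n := by
      rw [← Submodule.add_mem_iff_left _ hrest, ← hsum]
      exact hD hkn hd
    exact (DFinsupp.mem_support_iff.1 hn) (hg0 n _ this)
  obtain ⟨h, hh⟩ := exists_diagonal I
  obtain ⟨e, he⟩ := injective_iff_exists_smul.1 hinj _ (G ∘ₗ h)
  obtain ⟨i, hi, hei⟩ := hex e
  obtain ⟨k, rfl⟩ := Ordinal.lt_omega0.1 hi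
  obtain ⟨m, hm⟩ := hne k
  obtain ⟨r, hr, hrk⟩ := SetLike.not_le_iff_exists.1 hm
  -- All values `r • e` stay in `D k` along with `e`, so the `k`-th component of the diagonal
  -- vanishes, contradicting the choice of `r` outside `I k`.
  have h1 := key (h ⟨r, mem_eventualIdeal hI hr⟩) k (by
    have := he ⟨r, mem_eventualIdeal hI hr⟩
    rw [LinearMap.comp_apply] at this
    rw [this]
    exact (D k).smul_mem _ hei) k le_rfl
  rw [hh] at h1
  exact hrk ((Submodule.Quotient.mk_eq_zero _).1 h1)

/-! ### A swindle for mutually embedded injective modules. -/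

section Swindle

theorem exists_equiv_prod_of_injective {M U : Type u} [AddCommGroup M] [Module R M]
    [AddCommGroup U] [Module R U] (hM : Module.Injective R M) {i : M →ₗ[R] U}
    (hi : Function.Injective i) :
    ∃ D : Submodule R U, Nonempty (U ≃ₗ[R] M × D) := by
  obtain ⟨p, hp⟩ := exists_extension hM hi LinearMap.id
  have h := LinearMap.isCompl_of_proj (p := LinearMap.range i)
    (f := i.rangeRestrict ∘ₗ p) (by
      rintro ⟨_, x, rfl⟩
      exact Subtype.ext (congrArg i (LinearMap.congr_fun hp x)))
  exact ⟨_, ⟨(Submodule.prodEquivOfIsCompl _ _ h).symm.trans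
    ((LinearEquiv.ofInjective i hi).symm.prodCongr (LinearEquiv.refl R _))⟩⟩

/-- Finitely supported functions with values in a product. -/
noncomputable def finsuppProdEquiv (ι M N : Type*) [AddCommGroup M] [Module R M] [AddCommGroup N]
    [Module R N] : (ι →₀ M × N) ≃ₗ[R] (ι →₀ M) × (ι →₀ N) :=
  LinearEquiv.ofLinearMap
    ((Finsupp.mapRange.linearMap (LinearMap.fst R M N)).prod
      (Finsupp.mapRange.linearMap (LinearMap.snd R M N)))
    ((Finsupp.mapRange.linearMap (LinearMap.inl R M N)).coprod
      (Finsupp.mapRange.linearMap (LinearMap.inr R M N)))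
    (by
      apply LinearMap.ext
      rintro ⟨f, g⟩
      apply Prod.ext <;> ext <;> simp)
    (by
      apply LinearMap.ext
      intro f
      ext <;> simp)

/-- Mutual embeddings of injective modules, one of which is a countable power of itself, give an
isomorphism. -/
theorem nonempty_equiv_of_injective {M U : Type u} [AddCommGroup M] [Module R M]
    [AddCommGroup U] [Module R U] (hM : Module.Injective R M) (hU : Module.Injective R U)
    (e₁ : U ≃ₗ[R] (ℕ →₀ U)) (e₂ : U ≃ₗ[R] U × U) {i : M →ₗ[R] U} (hi : Function.Injective i)
    {j : U →ₗ[R] M} (hj : Function.Injective j) : Nonempty (M ≃ₗ[R] U) := by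
  obtain ⟨D, ⟨eD⟩⟩ := exists_equiv_prod_of_injective hM hi
  obtain ⟨D', ⟨eD'⟩⟩ := exists_equiv_prod_of_injective hU hj
  -- A countable direct sum of copies of `M × D` absorbs one more `M`, so `U` does. Likewise `M`,
  -- having `U` as a summand with `U ≃ U × U`, absorbs `U`. Hence `M ≃ U × M ≃ U`.
  let eN : U ≃ₗ[R] (ℕ →₀ M) × (ℕ →₀ D) :=
    (e₁.trans (Finsupp.mapRange.linearEquiv eD)).trans (finsuppProdEquiv ℕ M D)
  let eS : (ℕ →₀ M) ≃ₗ[R] M × (ℕ →₀ M) :=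
    ((Finsupp.domLCongr (Equiv.natSumPUnitEquivNat.{0}.symm.trans (Equiv.sumComm _ _))).trans
      (Finsupp.sumFinsuppLEquivProdFinsupp R)).trans
      ((Finsupp.uniqueLinearEquiv R M PUnit.unit).prodCongr (LinearEquiv.refl R _))
  -- `U ≃ M × U`
  let eU : U ≃ₗ[R] M × U :=
    ((eN.trans (eS.prodCongr (LinearEquiv.refl R _))).trans
      (LinearEquiv.prodAssoc R M (ℕ →₀ M) (ℕ →₀ D))).trans
      ((LinearEquiv.refl R M).prodCongr eN.symm)
  -- `M ≃ U × M`
  let eM : M ≃ₗ[R] U × M :=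
    ((eD'.trans (e₂.prodCongr (LinearEquiv.refl R _))).trans (LinearEquiv.prodAssoc R U U D')).trans
      ((LinearEquiv.refl R U).prodCongr eD'.symm)
  exact ⟨(eM.trans (LinearEquiv.prodComm R U M)).trans eU.symm⟩

end Swindle

variable {R : Type u} [Ring R]

/-! ### Size and universality of limit models. -/

section LimitModels

variable {κ : Cardinal.{u}} {α : Ordinal.{u}} {M : Type u} [AddCommGroup M] [Module R M]
  {N : Submodule R M}

theorem IsLimitModelOver.mk_le (hκ : ℵ₀ ≤ κ) (hα : α < (Order.succ κ).ord)
    (hM : IsLimitModelOver R κ α M N) : #M ≤ κ := by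
  obtain ⟨C, -, hcard, -, -, -, hex⟩ := hM
  exact mk_le_of_forall_exists_mem (C := fun i => (C i : Set M)) hκ hα
    (fun i hi => (hcard i hi).le) hex

theorem IsLimitModelOver.exists_embedding (hκ : ℵ₀ ≤ κ) (hα : 0 < α)
    (hM : IsLimitModelOver R κ α M N) (X : Type u) [AddCommGroup X] [Module R X] (hX : #X ≤ κ) :
    ∃ f : X →ₗ[R] M, Function.Injective f := by
  obtain ⟨C, -, hcard, -, -, hU, -⟩ := hM
  obtain ⟨_, -, -, hU⟩ := hU 0 hα
  have hinr : Function.Injective (LinearMap.inr R X (C 0)) := LinearMap.inr_injective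
  obtain ⟨f, hf, -⟩ := hU (X × C 0) (LinearMap.inr R X (C 0)) hinr (by
    refine le_antisymm ?_ (mk_le_of_injective hinr)
    rw [hcard 0 hα]
    exact mk_prod_le hκ hX (hcard 0 hα).le)
  exact ⟨Submodule.subtype _ ∘ₗ f ∘ₗ LinearMap.inl R X (C 0),
    Subtype.val_injective.comp (hf.comp LinearMap.inl_injective)⟩

end LimitModels

/-! ### Consequences of the noetherian condition. -/

section Noetherian

variable [IsNoetherianRing R] {κ : Cardinal.{u}}

/-- A map from a finitely generated left ideal meets only finitely many coordinates, so the
coordinatewise solutions can be cut to finite support. -/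
theorem injective_finsupp (ι : Type u) {V : Type u} [AddCommGroup V] [Module R V]
    (hV : Module.Injective R V) : Module.Injective R (ι →₀ V) := by
  classical
  rw [injective_iff_exists_smul] at *
  intro I f
  choose e he using fun i => hV I (Finsupp.lapply i ∘ₗ f)
  obtain ⟨t, ht⟩ := IsNoetherian.noetherian (⊤ : Submodule R I)
  let s : Finset ι := t.biUnion fun x => (f x).support
  have hs : ∀ i ∉ s, Finsupp.lapply i ∘ₗ f = 0 := by
    intro i hi
    refine LinearMap.ext_on ht fun x hx => ?_
    by_contra hne
    exact hi (Finset.mem_biUnion.2 ⟨x, hx, Finsupp.mem_support_iff.2 hne⟩)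
  refine ⟨Finsupp.indicator s fun i _ => e i, fun x => ?_⟩
  ext i
  by_cases hi : i ∈ s
  · simpa [Finsupp.indicator_apply, hi] using he i x
  · simpa [Finsupp.indicator_apply, hi] using LinearMap.congr_fun (hs i hi) x

theorem injective_of_chain {L : Type u} [AddCommGroup L] [Module R L] {δ : Ordinal.{u}}
    {C : Ordinal.{u} → Submodule R L} (hmono : ∀ i j, i ≤ j → j < δ → C i ≤ C j)
    (hinj : ∀ i < δ, Module.Injective R (C i)) (hex : ∀ x : L, ∃ i < δ, x ∈ C i) :
    Module.Injective R L := by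
  obtain ⟨i₀, hi₀, -⟩ := hex 0
  rw [injective_iff_exists_smul]
  intro I f
  obtain ⟨i, hi, hfi⟩ := bounded_of_isNoetherianRing (zero_le.trans_lt hi₀) hmono
    fun x => hex (f x)
  obtain ⟨e, he⟩ := injective_iff_exists_smul.1 (hinj i hi) I (f.codRestrict (C i) hfi)
  exact ⟨e, fun x => congrArg Subtype.val (he x)⟩

/-- Comparing with `κ.out →₀ U` instead of `U` supplies the self-decompositions required by the
swindle, because the index set absorbs doubling and multiplication by `ℕ`. -/
theorem IsUniversalInjective.nonempty_equiv {U M : Type u} [AddCommGroup U] [Module R U]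
    [AddCommGroup M] [Module R M] (hκ : #R + ℵ₀ ≤ κ) (hM : IsUniversalInjective R κ M)
    (hU : IsUniversalInjective R κ U) : Nonempty (M ≃ₗ[R] (κ.out →₀ U)) := by
  have hκ0 : ℵ₀ ≤ κ := le_add_self.trans hκ
  have hinf : Infinite κ.out := by rw [infinite_iff, mk_out]; exact hκ0
  obtain ⟨ea⟩ : Nonempty (κ.out ≃ ℕ × κ.out) := by
    rw [← lift_mk_eq']
    simp [mul_eq_right hκ0 hκ0 aleph0_ne_zero]
  obtain ⟨eb⟩ : Nonempty (κ.out ≃ κ.out ⊕ κ.out) := by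
    rw [← Cardinal.eq]
    simp [add_eq_self hκ0]
  obtain ⟨i, hi⟩ := hU.exists_embedding M hM.mk_le
  obtain ⟨j, hj⟩ := hM.exists_embedding (κ.out →₀ U)
    (mk_finsupp_le hκ0 (mk_out κ).le hU.mk_le)
  obtain ⟨a⟩ : Nonempty κ.out := inferInstance
  exact nonempty_equiv_of_injective hM.injective (injective_finsupp _ hU.injective)
    ((Finsupp.domLCongr ea).trans (Finsupp.curryLinearEquiv R))
    ((Finsupp.domLCongr eb).trans (Finsupp.sumFinsuppLEquivProdFinsupp R))
    (i := Finsupp.lsingle a ∘ₗ i) ((Finsupp.single_injective a).comp hi) hj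

theorem IsLimitModel.isUniversalInjective (hκ : #R + ℵ₀ ≤ κ) {M : Type u} [AddCommGroup M]
    [Module R M] (hM : IsLimitModel R κ M) : IsUniversalInjective R κ M := by
  obtain ⟨hκ0, α, hα, hακ, N, hM⟩ := hM
  exact ⟨hM.injective_of_isNoetherianRing hκ0 (le_self_add.trans hκ) hα, hM.mk_le hκ0 hακ,
    hM.exists_embedding hκ0 hα.bot_lt⟩

theorem uniqueLimitModels_of_isNoetherianRing [Nontrivial R] (hκ : #R + ℵ₀ ≤ κ) :
    UniqueLimitModels R κ := by
  have hs := HasSmallInjectives.of_isNoetherianRing hκ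
  constructor
  · have hω : Ordinal.omega0 < (Order.succ κ).ord := by
      rw [lt_ord, Ordinal.card_omega0]
      exact Order.lt_succ_of_le hs.aleph0_le
    obtain ⟨M, _, _, N, hM⟩ := exists_isLimitModelOver hs.aleph0_le hs.mk_ring_le
      hs.exists_universalOver Ordinal.isSuccLimit_omega0 hω
    exact ⟨M, _, _, hs.aleph0_le, _, Ordinal.isSuccLimit_omega0, hω, N, hM⟩
  · intro M N _ _ _ _ hM hN
    have hU := hM.isUniversalInjective hκ
    obtain ⟨e⟩ := hU.nonempty_equiv hκ hU
    obtain ⟨e'⟩ := (hN.isUniversalInjective hκ).nonempty_equiv hκ hU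
    exact ⟨e.trans e'.symm⟩

theorem hasSuperlimit_of_isNoetherianRing [Nontrivial R] (hκ : #R + ℵ₀ ≤ κ) :
    HasSuperlimit R κ := by
  have hs := HasSmallInjectives.of_isNoetherianRing hκ
  obtain ⟨U, _, _, hU⟩ := hs.exists_isUniversalInjective
  refine ⟨U, inferInstance, inferInstance, hκ, hU.mk_eq hs.aleph0_le hs.mk_ring_le, ?_, ?_⟩
  · intro N _ _ hN
    -- The spare factor `R` supplies an element outside the image of `N`.
    obtain ⟨f, hf⟩ := hU.exists_embedding (N × R) (mk_prod_le hs.aleph0_le hN.le hs.mk_ring_le)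
    refine ⟨f ∘ₗ LinearMap.inl R N R, hf.comp LinearMap.inl_injective, fun hsurj => ?_⟩
    obtain ⟨x, hx⟩ := hsurj (f (0, 1))
    exact zero_ne_one (congrArg Prod.snd (hf hx))
  · intro L _ _ δ C hδ hmono hC hex
    have hL : IsUniversalInjective R κ L := by
      refine ⟨injective_of_chain hmono (fun i hi => ?_) hex, ?_, fun N _ _ hN => ?_⟩
      · obtain ⟨e⟩ := hC i hi
        exact injective_of_equiv e.symm hU.injective
      · refine mk_le_of_forall_exists_mem (C := fun i => (C i : Set L)) hs.aleph0_le hδ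
          (fun i hi => ?_) hex
        obtain ⟨e⟩ := hC i hi
        exact (mk_congr e.toEquiv).le.trans hU.mk_le
      · obtain ⟨i, hi, -⟩ := hex 0
        obtain ⟨e⟩ := hC i hi
        obtain ⟨f, hf⟩ := hU.exists_embedding N hN
        exact ⟨Submodule.subtype _ ∘ₗ e.symm.toLinearMap ∘ₗ f,
          Subtype.val_injective.comp (e.symm.injective.comp hf)⟩
    obtain ⟨e⟩ := hL.nonempty_equiv hκ hU
    obtain ⟨e'⟩ := hU.nonempty_equiv hκ hU
    exact ⟨e.trans e'.symm⟩

theorem stable_of_isNoetherianRing (hκ : #R + ℵ₀ ≤ κ) : Stable R κ := by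
  have hs := HasSmallInjectives.of_isNoetherianRing hκ
  intro M _ _ hM
  obtain ⟨V, _, _, i, hi, hV, hU⟩ := hs.exists_universalOver M hM
  have hsurj : Function.Surjective fun v : V =>
      (Quotient.mk (galoisSetoid R M) ⟨V, i, hi, v⟩ : GaloisType R M) := by
    intro t
    induction t using Quotient.inductionOn with | h p => ?_
    let P := LinearMap.range p.emb ⊔ Submodule.span R {p.point}
    have hP : ∀ x, p.emb x ∈ P := fun x => Submodule.mem_sup_left ⟨x, rfl⟩
    have hpt : p.point ∈ P := Submodule.mem_sup_right (Submodule.mem_span_singleton_self _)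
    have hinj : Function.Injective (p.emb.codRestrict P hP) :=
      fun x y h => p.emb_injective (congrArg Subtype.val h)
    obtain ⟨f, hf, hfi⟩ := hU P (p.emb.codRestrict P hP) hinj (by
      refine le_antisymm ?_ (mk_le_of_injective hinj)
      rw [hM]
      refine mk_sup_le hs.aleph0_le ?_ (mk_span_le hs.aleph0_le hs.mk_ring_le ?_)
      · rw [← mk_congr (LinearEquiv.ofInjective _ p.emb_injective).toEquiv, hM]
      · rw [mk_singleton]
        exact one_le_aleph0.trans hs.aleph0_le)
    refine ⟨f ⟨p.point, hpt⟩, Quotient.sound ?_⟩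
    -- Cutting `p` down to the submodule generated by `M` and the point does not change its type and
    -- makes it small enough to embed in `V` over `M`.
    let p' : PointedExt R M := ⟨P, p.emb.codRestrict P hP, hinj, ⟨p.point, hpt⟩⟩
    refine Relation.TransGen.head (b := p') ?_ (Relation.TransGen.single ?_)
    · exact ⟨V, inferInstance, inferInstance, LinearMap.id, f, Function.injective_id, hf,
        hfi.symm, rfl⟩
    · exact ⟨p.carrier, inferInstance, inferInstance, P.subtype, LinearMap.id,
        P.injective_subtype, Function.injective_id, rfl, rfl⟩
  have := lift_mk_le_lift_mk_of_surjective hsurj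
  rwa [hV, hM, lift_id'.{u, u + 1}] at this

theorem sigmaInjective_of_isNoetherianRing (hκ : #R + ℵ₀ ≤ κ) {M : Type u} [AddCommGroup M]
    [Module R M] (hM : IsLimitModel R κ M) : SigmaInjective R M :=
  fun I => injective_finsupp I (hM.isUniversalInjective hκ).injective

end Noetherian

/-! ### Each condition forces the noetherian property. -/

section Converse

theorem isSuccLimit_ord_succ {μ : Cardinal.{u}} (hμ : ℵ₀ ≤ μ) :
    Order.IsSuccLimit (Order.succ μ).ord :=
  isSuccLimit_ord (hμ.trans (Order.le_succ μ))

theorem mk_lt_cof_ord_succ (R : Type u) [Ring R] :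
    #R < (Order.succ (#R + ℵ₀)).ord.cof := by
  rw [(isRegular_succ le_add_self).cof_ord]
  exact Order.lt_succ_of_le le_self_add

theorem omega0_lt_ord_succ {κ : Cardinal.{u}} (hκ : ℵ₀ ≤ κ) :
    Ordinal.omega0 < (Order.succ κ).ord := by
  rw [lt_ord, Ordinal.card_omega0]
  exact Order.lt_succ_of_le hκ

/-- Compare lengths `ω` and `(#R + ℵ₀)⁺`: the second gives an injective model, hence so does the
first. The bound on `χ` makes the second length admissible. -/
theorem isNoetherianRing_of_uniqueLimitModels [Nontrivial R] {χ : Cardinal.{u}}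
    (hχ : Order.succ (#R + ℵ₀) ≤ χ) (h : UniqueLimitModels R χ) : IsNoetherianRing R := by
  have hμ : #R + ℵ₀ ≤ χ := (Order.le_succ _).trans hχ
  have hχ0 : ℵ₀ ≤ χ := le_add_self.trans hμ
  have hR : #R ≤ χ := le_self_add.trans hμ
  obtain ⟨⟨L, _, _, hL⟩, huniq⟩ := h
  have hω := omega0_lt_ord_succ hχ0
  have hθ : (Order.succ (#R + ℵ₀)).ord < (Order.succ χ).ord :=
    ord_lt_ord.2 (Order.lt_succ_of_le hχ)
  have hθl := isSuccLimit_ord_succ (le_add_self : ℵ₀ ≤ #R + ℵ₀)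
  obtain ⟨M, _, _, N, hM⟩ := exists_isLimitModelOver hχ0 hR hL.exists_universalOver
    Ordinal.isSuccLimit_omega0 hω
  obtain ⟨M', _, _, N', hM'⟩ := exists_isLimitModelOver hχ0 hR hL.exists_universalOver hθl hθ
  obtain ⟨e⟩ := huniq M' M ⟨hχ0, _, hθl, hθ, N', hM'⟩
    ⟨hχ0, _, Ordinal.isSuccLimit_omega0, hω, N, hM⟩
  exact hM.isNoetherianRing hχ0 hR
    (injective_of_equiv e (hM'.injective_of_lt_cof hχ0 hR (mk_lt_cof_ord_succ R)))

theorem isNoetherianRing_of_sigmaInjective [Nontrivial R]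
    (h : ∀ (M : Type u) [AddCommGroup M] [Module R M],
      IsLimitModel R (2 ^ (#R + ℵ₀)) M → SigmaInjective R M) : IsNoetherianRing R := by
  have hs := HasSmallInjectives.two_power R
  have hω := omega0_lt_ord_succ hs.aleph0_le
  obtain ⟨M, _, _, N, hM⟩ := exists_isLimitModelOver hs.aleph0_le hs.mk_ring_le
    hs.exists_universalOver Ordinal.isSuccLimit_omega0 hω
  have hinj := h M ⟨hs.aleph0_le, _, Ordinal.isSuccLimit_omega0, hω, N, hM⟩ PUnit
  exact hM.isNoetherianRing hs.aleph0_le hs.mk_ring_le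
    (injective_of_equiv (Finsupp.uniqueLinearEquiv R M PUnit.unit) hinj)

theorem UniversalOver.comp_embedding {N V M : Type u} [AddCommGroup N] [Module R N]
    [AddCommGroup V] [Module R V] [AddCommGroup M] [Module R M] {i : N →ₗ[R] V}
    (hi : UniversalOver i) {f : V →ₗ[R] M} (hf : Function.Injective f) (hM : #M = #N) :
    UniversalOver (f ∘ₗ i) := by
  refine ⟨hf.comp hi.1, hM, fun N' _ _ j hj hN' => ?_⟩
  obtain ⟨k, hk, hkj⟩ := hi.2.2 N' j hj hN'
  exact ⟨f ∘ₗ k, hf.comp hk, by rw [LinearMap.comp_assoc, hkj]⟩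

/-- A superlimit in a cardinal where universal extensions exist is a limit model of every length. -/
theorem IsSuperlimit.exists_isLimitModelOver {κ : Cardinal.{u}} {M : Type u} [AddCommGroup M]
    [Module R M] (hM : IsSuperlimit R κ M)
    (hU : ∀ (M : Type u) [AddCommGroup M] [Module R M], #M = κ →
      ∃ (M' : Type u) (_ : AddCommGroup M') (_ : Module R M') (i : M →ₗ[R] M'), UniversalOver i)
    {α : Ordinal.{u}} (hα : Order.IsSuccLimit α) (hακ : α < (Order.succ κ).ord) :
    ∃ (L : Type u) (_ : AddCommGroup L) (_ : Module R L) (N : Submodule R L),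
      IsLimitModelOver R κ α L N ∧ Nonempty (L ≃ₗ[R] M) := by
  obtain ⟨-, hMκ, huniv, hunion⟩ := hM
  obtain ⟨E, _, _, hE⟩ := exists_amalgamation_module R κ
  obtain ⟨g, hg, -⟩ := hE PUnit M 0 0 (Function.injective_of_subsingleton _)
    (Function.injective_of_subsingleton _) hMκ.le
  have hlim : ∀ i < (Order.succ κ).ord, Order.IsSuccLimit i →
      ∀ C : Ordinal.{u} → Submodule R E, Monotone C → (∀ j < i, Nonempty (C j ≃ₗ[R] M)) →
      Nonempty ((⨆ j : Set.Iio i, C j : Submodule R E) ≃ₗ[R] M) := by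
    intro i hi hil C hC hCM
    have hle : ∀ j < i, C j ≤ ⨆ k : Set.Iio i, C k := fun j hj =>
      le_iSup (fun k : Set.Iio i => C k) ⟨j, hj⟩
    refine hunion _ i (fun j => (C j).submoduleOf _) hi (fun j k hjk _ x hx => hC hjk hx)
      (fun j hj => ?_) ?_
    · obtain ⟨e⟩ := hCM j hj
      exact ⟨(Submodule.submoduleOfEquivOfLe (hle j hj)).trans e⟩
    · rintro ⟨x, hx⟩
      exact (mem_iSup_Iio hil.bot_lt fun j k h _ => hC h).1 hx
  obtain ⟨C, -, hmono, hcont, hP, hQ⟩ := exists_continuous_chain α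
    (fun N : Submodule R E => Nonempty (N ≃ₗ[R] M)) UniversalBetween (LinearMap.range g)
    ⟨(LinearEquiv.ofInjective g hg).symm⟩
    (by
      rintro N ⟨e⟩
      have hN : #N = κ := by rw [mk_congr e.toEquiv, hMκ]
      obtain ⟨V, _, _, i, hi⟩ := hU N hN
      obtain ⟨f, hf, -⟩ := huniv V (hi.2.1.trans hN)
      -- Embedding a universal extension of `N` in `M` makes `M` itself universal over `N`, so the
      -- next stage can again be a copy of `M`. Limit stages are copies by the union clause.
      have hfi := hi.comp_embedding hf (hMκ.trans hN.symm)
      obtain ⟨k, hk, hki⟩ := hE N M N.subtype (f ∘ₗ i) N.injective_subtype hfi.1 hMκ.le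
      have hb := hfi.between hk hki
      exact ⟨_, hb.1, ⟨(LinearEquiv.ofInjective k hk).symm⟩, hb⟩)
    (fun i hi => hlim i (hi.trans hακ))
  refine ⟨_, _, _, _, isLimitModelOver_iSup hα hmono hcont (fun i hi => ?_) hQ,
    hlim α hακ hα C hmono hP⟩
  obtain ⟨e⟩ := hP i hi
  rw [mk_congr e.toEquiv, hMκ]

theorem isNoetherianRing_of_hasSuperlimit (h : HasSuperlimit R (2 ^ (#R + ℵ₀))) :
    IsNoetherianRing R := by
  have hs := HasSmallInjectives.two_power R
  obtain ⟨M, _, _, hM⟩ := h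
  obtain ⟨L, _, _, N, hL, ⟨e⟩⟩ := hM.exists_isLimitModelOver hs.exists_universalOver
    Ordinal.isSuccLimit_omega0 (omega0_lt_ord_succ hs.aleph0_le)
  obtain ⟨L', _, _, N', hL', ⟨e'⟩⟩ := hM.exists_isLimitModelOver hs.exists_universalOver
    (isSuccLimit_ord_succ (le_add_self : ℵ₀ ≤ #R + ℵ₀))
    (ord_lt_ord.2 (Order.lt_succ_of_le (Order.succ_le_of_lt (cantor _))))
  exact hL.isNoetherianRing hs.aleph0_le hs.mk_ring_le (injective_of_equiv (e'.trans e.symm)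
    (hL'.injective_of_lt_cof hs.aleph0_le hs.mk_ring_le (mk_lt_cof_ord_succ R)))

/-- Galois types determine the equations `r • b = m` satisfied by their point; this is how types are
told apart. -/
theorem PointedExt.smul_point_iff_of_transGen {M : Type u} [AddCommGroup M] [Module R M]
    {p q : PointedExt R M} (h : Relation.TransGen PointedExt.AtRel p q) (r : R) (m : M) :
    r • p.point = p.emb m ↔ r • q.point = q.emb m := by
  have step : ∀ p q : PointedExt R M, p.AtRel q →
      (r • p.point = p.emb m ↔ r • q.point = q.emb m) := by
    rintro p q ⟨L, _, _, f, g, hf, hg, h1, h2⟩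
    rw [← hf.eq_iff, ← hg.eq_iff, map_smul, map_smul, h2]
    have : f (p.emb m) = g (q.emb m) := LinearMap.congr_fun h1 m
    rw [this]
  induction h with
  | single h => exact step _ _ h
  | tail _ h ih => exact ih.trans (step _ _ h)

theorem mk_dfinsupp_quotient_le (I : ℕ → Ideal R) {κ : Cardinal.{u}} (hκ : ℵ₀ ≤ κ)
    (hR : #R ≤ κ) : #(Π₀ n, R ⧸ I n) ≤ κ := by
  classical
  let a : ℕ → Π₀ n, R ⧸ I n := fun n => DFinsupp.single n (Submodule.Quotient.mk 1)
  have htop : Submodule.span R (Set.range a) = ⊤ := by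
    rw [eq_top_iff]
    rintro d -
    induction d using DFinsupp.induction with
    | h0 => exact zero_mem _
    | ha n x f _ _ ih =>
      refine add_mem ?_ ih
      obtain ⟨r, rfl⟩ := Submodule.Quotient.mk_surjective _ x
      have : (DFinsupp.single n (Submodule.Quotient.mk r) : Π₀ n, R ⧸ I n) = r • a n := by
        simp only [a, ← DFinsupp.single_smul, ← Submodule.Quotient.mk_smul, smul_eq_mul, mul_one]
      rw [this]
      exact Submodule.smul_mem _ r (Submodule.subset_span ⟨n, rfl⟩)
  have h := mk_span_le (R := R) hκ hR (s := Set.range a)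
    ((mk_le_aleph0_iff.2 (Set.countable_range a)).trans hκ)
  rw [htop] at h
  rwa [← mk_congr (Submodule.topEquiv (R := R) (M := Π₀ n, R ⧸ I n)).toEquiv]

/-- Alephs of cofinality `ω` occur above every cardinal, and König's inequality applies to them. -/
theorem exists_le_lt_power_aleph0 (μ : Cardinal.{u}) :
    ∃ κ : Cardinal.{u}, μ ≤ κ ∧ ℵ₀ ≤ κ ∧ κ < κ ^ (ℵ₀ : Cardinal.{u}) := by
  refine ⟨ℵ_ (μ.ord + Ordinal.omega0), ?_, aleph0_le_aleph _, ?_⟩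
  · refine le_trans ?_ (aleph_le_aleph.2 le_self_add)
    exact le_aleph_ord μ
  · have h := lt_power_cof_ord (aleph0_le_aleph (μ.ord + Ordinal.omega0))
    rwa [ord_aleph, Ordinal.cof_omega (Ordinal.isSuccLimit_add _ Ordinal.isSuccLimit_omega0),
      Ordinal.cof_add _ Ordinal.omega0_ne_zero, Ordinal.cof_omega0] at h

/-- A map from a left ideal to a countable direct sum that is unbounded in the sum yields, over a
direct sum of `κ` copies, `κ ^ ℵ₀` Galois types. -/
theorem not_stable_of_unbounded {β : ℕ → Type u} [∀ n, AddCommGroup (β n)] [∀ n, Module R (β n)]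
    {κ : Cardinal.{u}} (hκ : ℵ₀ ≤ κ) (hβ : #(Π₀ n, β n) ≤ κ) (hpow : κ < κ ^ (ℵ₀ : Cardinal.{u}))
    {I : Ideal R} (d : I →ₗ[R] Π₀ n, β n) (hd : ∀ n, ∃ r, d r n ≠ 0) : ¬ Stable R κ := by
  classical
  intro h
  have hinf : Infinite κ.out := by rw [infinite_iff, mk_out]; exact hκ
  have hnt : Nontrivial (Π₀ n, β n) := by
    obtain ⟨r, hr⟩ := hd 0
    exact ⟨d r, 0, fun h0 => hr (by rw [h0]; rfl)⟩
  have hM : #(κ.out →₀ Π₀ n, β n) = κ := by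
    rw [mk_finsupp_of_infinite, mk_out]
    exact max_eq_left hβ
  -- `F η` sends the `n`-th component to the copy numbered `η n`; each branch `η` gives its own
  -- version of `d`.
  let F : (ℕ → κ.out) → (Π₀ n, β n) →ₗ[R] (κ.out →₀ Π₀ n, β n) := fun η =>
    DFinsupp.lsum ℕ fun n => Finsupp.lsingle (η n) ∘ₗ DFinsupp.lsingle n
  have hF : ∀ η x a n, F η x a n = if η n = a then x n else 0 := by
    intro η x a n
    induction x using DFinsupp.induction with
    | h0 => simp
    | ha k y f _ _ ih =>
      have h1 : F η (DFinsupp.single k y) = Finsupp.single (η k) (DFinsupp.single k y) := by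
        simp [F]
      rw [map_add, h1, Finsupp.add_apply, DFinsupp.add_apply, DFinsupp.add_apply, ih]
      by_cases hk : k = n
      · subst hk
        by_cases ha : η k = a
        · simp [ha]
        · simp [ha, Finsupp.single_eq_of_ne (Ne.symm ha)]
      · have h2 : ∀ b : κ.out, (Finsupp.single (η k) (DFinsupp.single k y : Π₀ n, β n) b) n = 0 := by
          intro b
          rw [Finsupp.single_apply]
          split_ifs
          · exact DFinsupp.single_eq_of_ne (Ne.symm hk)
          · rfl
        rw [h2, DFinsupp.single_eq_of_ne (Ne.symm hk)]
        simp
  obtain ⟨E, _, _, hE, g, hg⟩ := exists_injective_embedding (R := R) (κ.out →₀ Π₀ n, β n)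
  choose e he using fun η => injective_iff_exists_smul.1 hE _ (g ∘ₗ F η ∘ₗ d)
  have hinj : Function.Injective fun η : ℕ → κ.out =>
      (Quotient.mk (galoisSetoid R (κ.out →₀ Π₀ n, β n)) ⟨E, g, hg, e η⟩ :
        GaloisType R (κ.out →₀ Π₀ n, β n)) := by
    intro η ν hην
    have hrel := Quotient.exact hην
    funext n
    obtain ⟨r, hr⟩ := hd n
    -- Equal types make `F η` and `F ν` agree at `d r`. Component `n` in copy `η n` is `d r n ≠ 0`
    -- for `η`, but `0` for `ν` unless `ν n = η n`.
    have h1 := (PointedExt.smul_point_iff_of_transGen hrel r (F η (d r))).1 (he η r).symm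
    have h2 : F ν (d r) = F η (d r) := hg ((he ν r).trans h1)
    by_contra hne
    have h3 := hF η (d r) (η n) n
    rw [← h2, hF, if_pos rfl, if_neg (Ne.symm hne)] at h3
    exact hr h3.symm
  have h1 := lift_mk_le_lift_mk_of_injective hinj
  have h2 := h (κ.out →₀ Π₀ n, β n) hM
  have h3 : #(ℕ → κ.out) = κ ^ (ℵ₀ : Cardinal.{u}) := by simp
  rw [h3, lift_id'.{u, u + 1}] at h1
  have h4 := h1.trans h2
  rw [lift_umax.{u, u + 1}, lift_le] at h4
  exact absurd hpow (not_lt.2 h4)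

theorem isNoetherianRing_of_stable {κ : Cardinal.{u}} (hκ : ℵ₀ ≤ κ) (hR : #R ≤ κ)
    (hpow : κ < κ ^ (ℵ₀ : Cardinal.{u})) (h : Stable R κ) : IsNoetherianRing R := by
  refine isNoetherianRing_of_not_exists_chain fun I hI hne => ?_
  obtain ⟨d, hd⟩ := exists_diagonal I
  refine not_stable_of_unbounded hκ (mk_dfinsupp_quotient_le I hκ hR) hpow d (fun n => ?_) h
  obtain ⟨m, hm⟩ := hne n
  obtain ⟨r, hr, hrn⟩ := SetLike.not_le_iff_exists.1 hm
  refine ⟨⟨r, mem_eventualIdeal hI hr⟩, fun h0 => hrn ?_⟩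
  rw [hd] at h0
  exact (Submodule.Quotient.mk_eq_zero _).1 h0

end Converse

end ModEmb

theorem theorem3p12 (R : Type u) [Ring R] [Nontrivial R] :
    List.TFAE [
      IsNoetherianRing R,
      ModEmb.Superstable R,
      ∀ κ : Cardinal.{u}, #R + ℵ₀ ≤ κ → ∃ χ : Cardinal.{u}, κ ≤ χ ∧ ModEmb.UniqueLimitModels R χ,
      ∀ κ : Cardinal.{u}, #R + ℵ₀ ≤ κ → ModEmb.UniqueLimitModels R κ,
      ∀ κ : Cardinal.{u}, Order.succ (#R + ℵ₀) ≤ κ → ModEmb.HasSuperlimit R κ,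
      ∀ κ : Cardinal.{u}, #R + ℵ₀ ≤ κ → ModEmb.Stable R κ,
      ∀ κ : Cardinal.{u}, #R + ℵ₀ ≤ κ →
        ∀ (M : Type u) [AddCommGroup M] [Module R M],
          ModEmb.IsLimitModel R κ M → ModEmb.SigmaInjective R M] := by
  tfae_have 1 → 4 := fun _ _ hκ => ModEmb.uniqueLimitModels_of_isNoetherianRing hκ
  tfae_have 4 → 2 := fun h => ⟨_, h⟩
  tfae_have 2 → 3 := fun ⟨μ, h⟩ κ _ => ⟨max κ μ, le_max_left _ _, h _ (le_max_right _ _)⟩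
  tfae_have 3 → 1 := fun h => by
    obtain ⟨χ, hχ, hu⟩ := h _ (Order.le_succ (#R + ℵ₀))
    exact ModEmb.isNoetherianRing_of_uniqueLimitModels hχ hu
  tfae_have 1 → 5 := fun _ κ hκ =>
    ModEmb.hasSuperlimit_of_isNoetherianRing ((Order.le_succ _).trans hκ)
  tfae_have 5 → 1 := fun h =>
    ModEmb.isNoetherianRing_of_hasSuperlimit (h _ (Order.succ_le_of_lt (cantor _)))
  tfae_have 1 → 6 := fun _ _ hκ => ModEmb.stable_of_isNoetherianRing hκ
  tfae_have 6 → 1 := fun h => by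
    obtain ⟨κ, hμ, hκ, hpow⟩ := ModEmb.exists_le_lt_power_aleph0 (#R + ℵ₀)
    exact ModEmb.isNoetherianRing_of_stable hκ (le_self_add.trans hμ) hpow (h κ hμ)
  tfae_have 1 → 7 := fun _ _ hκ _ _ _ hM => ModEmb.sigmaInjective_of_isNoetherianRing hκ hM
  tfae_have 7 → 1 := fun h => ModEmb.isNoetherianRing_of_sigmaInjective (h _ (cantor _).le)
  tfae_finish
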